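/- **Setting.** A buyer has valuation $Y\in[0,1]$ and covariate $X\in[0,1]$. For a joint law $F_{Y,X}$ with conditional density $f_{Y|X}(y|x)$, conditional distribution function $F_{Y|X}$ and marginal density $f_X$, put $r(y,x)=y\,(1-F_{Y|X}(y|x))$. Let $p_D^*$ be an optimal third-degree price discrimination (3PD) strategy, i.e. a maximizer of $R(p)=\int_0^1 r(p(x),x)f_X(x)\,dx$ over measurable $p:[0,1]\to[0,1]$, and let $W(p,F_{Y,X})=\mathbb E_{F_{Y,X}}[Y\mathbf 1\{Y>p(X)\}]$. For positive constants $C_0,C^*,\overline C,\overline C',\underline C$ let $\mathcal F$ be the set of joint laws on $[0,1]^2$ such that: (a) $|f_{Y|X}(y|x)-f_{Y|X}(y'|x)|\le C_0|y-y'|$ for all $y,y',x\in[0,1]$; (b) for each $x$, $r(\cdot,x)$ is strictly concave on $[0,1]$, and $-2f_{Y|X}(y|x)-y\,\partial_yf_{Y|X}(y|x)\le -C^*$ a.e.; (c) for each $x\in[0,1]$ the maximizer $p^*(x)$ of $r(\cdot,x)$ over $[0,1]$ lies in $(0,1)$; (d) $f_{Y|X}$ and $F_{Y|X}$ are continuously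 differentiable in $(x,y)$ in a neighborhood, relative to $[0,1]^2$, of the curve $\{(x,p^*(x)):x\in[0,1]\}$; (e) $|2f_{Y|X}+y\,\partial_yf_{Y|X}|$ and $|\partial_xF_{Y|X}+y\,\partial_xf_{Y|X}|$ exist and are at most $\overline C$ a.e. on $[0,1]^2$; (f) $\underline C\le f_X\le\overline C'$ on $[0,1]$. For a law $F_Y$ on $[0,1]$ with density $f_Y$, let $p_U^*$ maximize $R_U(p)=p(1-F_Y(p))$ over $[0,1]$, and let $W(p,F_Y)=\mathbb E_{F_Y}[Y\mathbf 1\{Y>p\}]$. For positive $C_0,C^*,\overline C$ let $\mathcal F^U$ be the set of such laws with $f_Y$ $C_0$-Lipschitz on $[0,1]$, $R_U$ strictly concave with $-2f_Y-yf_Y'\le -C^*$ a.e., $|2f_Y+yf_Y'|\le\overline C$ a.e., $p_U^*\in(0,1)$, and $f_Y$ continuously differentiable near $p_U^*$. **Strategies.** Given i.i.d. data $(Y_i,X_i)_{i\le n}$ from $F_{Y,X}$ and $I_k=[(k-1)/K,k/K)$, the $K$-markets ERM strategy charges on $I_k$ a (measurably selected) price $\hat p_k\in\arg\max_{p\in[0,1]}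 p\cdot\frac{\#\{i:X_i\in I_k,\,Y_i\ge p\}}{\#\{i:X_i\in I_k\}}$ when $I_k$ contains an observation, and an arbitrary price in $[0,1]$ (measurable in the data) otherwise; write $\hat p_D$ for the resulting pricing function. Given i.i.d. data $Y_1,\dots,Y_n$ from $F_Y$, the uniform ERM strategy is a (measurably selected) $\hat p_U\in\arg\max_{p\in[0,1]}p\cdot\frac1n\#\{i:Y_i\ge p\}$. **Theorem.** (i) For all $0<c_1\le c_2$ there is a constant $C$, depending only on $c_1,c_2$ and the constants defining $\mathcal F$, such that for all $n\ge1$ and all $K$ with $c_1n^{1/4}\le K\le c_2n^{1/4}$, $$\sup_{F_{Y,X}\in\mathcal F}\mathbb E_{F_{Y,X}}\bigl|W(\hat p_D,F_{Y,X})-W(p_D^*,F_{Y,X})\bigr|\le C\,n^{-1/4}.$$ (ii) There is a constant $C$, depending only on the constants defining $\mathcal F^U$, such that for all $n\ge1$, $$\sup_{F_Y\in\mathcal F^U}\mathbb E_{F_Y}\bigl|W(\hat p_U,F_Y)-W(p_U^*,F_Y)\bigr|\le C\,n^{-1/3}.$$ -/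

import Mathlib

open MeasureTheory Set

noncomputable section

namespace Pricing

/-- The unit square `[0,1] × [0,1]`. Points of `ℝ × ℝ` are pairs `(y, x)`: valuation first,
covariate second. -/
def unitSquare : Set (ℝ × ℝ) := Icc 0 1 ×ˢ Icc 0 1

/-! ### Joint distributions of (Y, X) -/

/-- A joint distribution of `(Y, X)` on the unit square, given by a conditional density
`f y x = f_{Y|X}(y|x)` and a marginal density `fX x = f_X(x)`. Only the values on `[0,1]` of the
arguments matter. -/
structure JointDist where
  f : ℝ → ℝ → ℝ
  fX : ℝ → ℝ
  measurable_f : Measurable (Function.uncurry f)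
  measurable_fX : Measurable fX
  f_nonneg : ∀ y ∈ Icc (0 : ℝ) 1, ∀ x ∈ Icc (0 : ℝ) 1, 0 ≤ f y x
  fX_nonneg : ∀ x ∈ Icc (0 : ℝ) 1, 0 ≤ fX x
  integrable_f : ∀ x ∈ Icc (0 : ℝ) 1, IntegrableOn (fun y => f y x) (Icc 0 1)
  integrable_fX : IntegrableOn fX (Icc 0 1)
  integral_f : ∀ x ∈ Icc (0 : ℝ) 1, ∫ y in Icc (0 : ℝ) 1, f y x = 1
  integral_fX : ∫ x in Icc (0 : ℝ) 1, fX x = 1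

namespace JointDist

variable (J : JointDist)

/-- The joint law `F_{Y,X}` as a measure, with density `f_{Y|X}(y|x) f_X(x)` on the square. -/
def law : Measure (ℝ × ℝ) :=
  ((volume : Measure (ℝ × ℝ)).restrict unitSquare).withDensity
    (fun z => ENNReal.ofReal (J.f z.1 z.2 * J.fX z.2))

/-- The conditional distribution function `F_{Y|X}(y|x)`. -/
def condCDF (y x : ℝ) : ℝ := ∫ t in (0 : ℝ)..y, J.f t x

/-- The revenue `r(y, x) = y (1 - F_{Y|X}(y|x))` from price `y` at covariate value `x`. -/
def rev (y x : ℝ) : ℝ := y * (1 - J.condCDF y x)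

/-- The expected revenue `R(p, F_{Y,X})` of a pricing function `p`. -/
def expRev (p : ℝ → ℝ) : ℝ := ∫ x in Icc (0 : ℝ) 1, J.rev (p x) x * J.fX x

end JointDist

/-- Pricing functions: measurable maps `[0,1] → [0,1]` (extended measurably to `ℝ`). -/
def IsPricing (p : ℝ → ℝ) : Prop :=
  Measurable p ∧ ∀ x ∈ Icc (0 : ℝ) 1, p x ∈ Icc (0 : ℝ) 1

/-- `p` is an optimal third-degree price discrimination strategy for the true distribution. -/
def JointDist.IsOptimal (J : JointDist) (p : ℝ → ℝ) : Prop :=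
  IsPricing p ∧ ∀ q, IsPricing q → J.expRev q ≤ J.expRev p

/-- The welfare `W(p, F_{Y,X}) = E[Y 1{Y > p(X)}]` of a pricing function. -/
def welfare (μ : Measure (ℝ × ℝ)) (p : ℝ → ℝ) : ℝ :=
  ∫ z, {z : ℝ × ℝ | p z.2 < z.1}.indicator Prod.fst z ∂μ

/-- The class of joint distributions, with constants `C₀` (Lipschitz), `Cs` (strong concavity),
`Cb` (bound on derivatives of the marginal revenue), `U` and `L` (bounds on the density of `X`). -/
structure JointDist.InClass (C₀ Cs Cb U L : ℝ) (J : JointDist) : Prop where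
  lipschitz : ∀ y ∈ Icc (0 : ℝ) 1, ∀ y' ∈ Icc (0 : ℝ) 1, ∀ x ∈ Icc (0 : ℝ) 1,
    |J.f y x - J.f y' x| ≤ C₀ * |y - y'|
  strictConcave : ∀ x ∈ Icc (0 : ℝ) 1, StrictConcaveOn ℝ (Icc 0 1) (fun y => J.rev y x)
  strongConcave : ∀ᵐ z ∂((volume : Measure (ℝ × ℝ)).restrict unitSquare),
    -2 * J.f z.1 z.2 - z.1 * deriv (fun y => J.f y z.2) z.1 ≤ -Cs
  /-- Interior pointwise optimal prices, and continuous differentiability of `f_{Y|X}` and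
  `F_{Y|X}` in both variables near the optimal price curve, relative to the unit square. -/
  interior_smooth : ∃ pstar : ℝ → ℝ,
    (∀ x ∈ Icc (0 : ℝ) 1,
      pstar x ∈ Ioo (0 : ℝ) 1 ∧ IsMaxOn (fun y => J.rev y x) (Icc 0 1) (pstar x)) ∧
    ∃ V : Set (ℝ × ℝ), IsOpen V ∧ (∀ x ∈ Icc (0 : ℝ) 1, (pstar x, x) ∈ V) ∧
      ContDiffOn ℝ 1 (fun z : ℝ × ℝ => J.f z.1 z.2) (V ∩ unitSquare) ∧
      ContDiffOn ℝ 1 (fun z : ℝ × ℝ => J.condCDF z.1 z.2) (V ∩ unitSquare)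
  bounded_y : ∀ᵐ z ∂((volume : Measure (ℝ × ℝ)).restrict unitSquare),
    |2 * J.f z.1 z.2 + z.1 * deriv (fun y => J.f y z.2) z.1| ≤ Cb
  bounded_x : ∀ᵐ z ∂((volume : Measure (ℝ × ℝ)).restrict unitSquare),
    DifferentiableAt ℝ (fun x => J.condCDF z.1 x) z.2 ∧
    DifferentiableAt ℝ (fun x => J.f z.1 x) z.2 ∧
    |deriv (fun x => J.condCDF z.1 x) z.2 + z.1 * deriv (fun x => J.f z.1 x) z.2| ≤ Cb
  marginal : ∀ x ∈ Icc (0 : ℝ) 1, L ≤ J.fX x ∧ J.fX x ≤ U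

/-! ### The K-markets ERM strategy -/

/-- The `k`-th of `K` markets: `[k/K, (k+1)/K)`, with `k = 0, …, K-1`. -/
def market (K : ℕ) (k : Fin K) : Set ℝ := Ico ((k : ℝ) / K) (((k : ℝ) + 1) / K)

open Classical in
/-- The empirical revenue `p ⬝ #{i : X_i ∈ I, Y_i ≥ p} / #{i : X_i ∈ I}` of price `p` in the
market `I` (only used when some observation lies in `I`). -/
def empMarketRev {n : ℕ} (d : Fin n → ℝ × ℝ) (I : Set ℝ) (p : ℝ) : ℝ :=
  p * (((Finset.univ.filter fun i => (d i).2 ∈ I ∧ p ≤ (d i).1).card : ℝ) /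
    ((Finset.univ.filter fun i => (d i).2 ∈ I).card : ℝ))

/-- `π d k` is a (measurably chosen) price in `[0,1]` that maximizes the empirical revenue of
market `k` for the sample `d`; it is unconstrained if market `k` has no observation. -/
structure IsKMarketsERM (n K : ℕ) (π : (Fin n → ℝ × ℝ) → Fin K → ℝ) : Prop where
  measurable : Measurable π
  mem : ∀ d k, π d k ∈ Icc (0 : ℝ) 1
  isMax : ∀ d k, (∃ i, (d i).2 ∈ market K k) →
    IsMaxOn (empMarketRev d (market K k)) (Icc 0 1) (π d k)

/-- The piecewise constant pricing function that charges `q k` on market `k`. (At `x = 1`, which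
lies in no market and has probability zero, its value is `0`.) -/
def piecewisePrice {K : ℕ} (q : Fin K → ℝ) (x : ℝ) : ℝ :=
  ∑ k, (market K k).indicator (fun _ => q k) x

/-! ### Marginal distributions of Y and uniform pricing -/

/-- A distribution of `Y` on `[0,1]` given by a density `g`. -/
structure MargDist where
  g : ℝ → ℝ
  measurable_g : Measurable g
  g_nonneg : ∀ y ∈ Icc (0 : ℝ) 1, 0 ≤ g y
  integrable_g : IntegrableOn g (Icc 0 1)
  integral_g : ∫ y in Icc (0 : ℝ) 1, g y = 1

namespace MargDist

variable (G : MargDist)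

/-- The law `F_Y` as a measure. -/
def law : Measure ℝ :=
  ((volume : Measure ℝ).restrict (Icc 0 1)).withDensity (fun y => ENNReal.ofReal (G.g y))

/-- The revenue `R(p, F_Y) = p (1 - F_Y(p))` of the uniform price `p`. -/
def rev (p : ℝ) : ℝ := p * (1 - ∫ t in (0 : ℝ)..p, G.g t)

/-- `p` is an optimal uniform price for the true distribution. -/
def IsOptimal (p : ℝ) : Prop := p ∈ Icc (0 : ℝ) 1 ∧ IsMaxOn G.rev (Icc 0 1) p

/-- The class of marginal distributions, with constants `C₀` (Lipschitz), `Cs` (strong concavity)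
and `Cb` (bound on the second derivative of the revenue). -/
structure InClass (C₀ Cs Cb : ℝ) (G : MargDist) : Prop where
  lipschitz : ∀ y ∈ Icc (0 : ℝ) 1, ∀ y' ∈ Icc (0 : ℝ) 1, |G.g y - G.g y'| ≤ C₀ * |y - y'|
  strictConcave : StrictConcaveOn ℝ (Icc 0 1) G.rev
  strongConcave : ∀ᵐ y ∂((volume : Measure ℝ).restrict (Icc 0 1)),
    -2 * G.g y - y * deriv G.g y ≤ -Cs
  bounded : ∀ᵐ y ∂((volume : Measure ℝ).restrict (Icc 0 1)),
    |2 * G.g y + y * deriv G.g y| ≤ Cb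
  interior_smooth : ∃ p ∈ Ioo (0 : ℝ) 1, IsMaxOn G.rev (Icc 0 1) p ∧ ContDiffAt ℝ 1 G.g p

end MargDist

/-- The welfare `W(p, F_Y) = E[Y 1{Y > p}]` of the uniform price `p`. -/
def welfareU (μ : Measure ℝ) (p : ℝ) : ℝ := ∫ y, (Ioi p).indicator (fun y => y) y ∂μ

open Classical in
/-- The empirical revenue `p ⬝ #{i : Y_i ≥ p} / n` of the uniform price `p`. -/
def empRev {n : ℕ} (d : Fin n → ℝ) (p : ℝ) : ℝ :=
  p * (((Finset.univ.filter fun i => p ≤ d i).card : ℝ) / (n : ℝ))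

/-- `π d` is a (measurably chosen) price in `[0,1]` that maximizes the empirical revenue of the
sample `d`. -/
structure IsUniformERM (n : ℕ) (π : (Fin n → ℝ) → ℝ) : Prop where
  measurable : Measurable π
  mem : ∀ d, π d ∈ Icc (0 : ℝ) 1
  isMax : ∀ d, IsMaxOn (empRev d) (Icc 0 1) (π d)

end Pricing

end

/-! Welfare is Lipschitz in the price: two pricing functions differ in welfare by at most the
probability that Y falls between them, and the law has a bounded density. So it is enough to bound
the expected distance of the ERM price from the optimal price (`abs_welfare_sub_le`,
`integral_abs_piecewisePrice_sub_le`).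

The statistical error has a cube-root rate (`integral_abs_erm_sub_le`). In a market of mass q,
strong concavity makes the expected empirical count-revenue fall by order n q δ² at distance δ from
its maximizer p₀. The count of observations between p₀ and p₀ ± δ fluctuates by only (n q δ)^(1/2).
The two balance at δ of order (n q)^(-1/3). The supremum of the fluctuation is handled by a
Kolmogorov inequality: centred counts along increasing sets, divided by one minus the probability of
the set, form a martingale. The tail is then of order 1/(n q δ³), which is summable over dyadic
shells.

With one market q = 1, and this is part (ii). With K markets q ≥ L/K, and there is a bias too: a
single price replaces the curve of pointwise optimal prices. That curve is Lipschitz with constant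
Cb/Cs (`InClass.exists_optimalPrice`), by an implicit function argument on the first order
condition. The best price in a market is therefore within order 1/K of the curve
(`InClass.exists_marketPrice`). The total (K/n)^(1/3) + 1/K is of order n^(-1/4) when K is of order
n^(1/4). -/

namespace Pricing

/-! ### Kolmogorov's inequality for centred counts -/

section MaximalInequality

variable {Ω : Type*} [MeasurableSpace Ω]

/-- Integrate over coordinate i first. On A the factor ξ vanishes, and off A the factor φ does not
see the coordinate, so φ comes out and leaves the mean of ξ. This is the orthogonality of martingale
increments: φ is the past, which sees coordinate i only inside A. -/
theorem integral_pi_mul_eval_eq_zero {n : ℕ} (μ : Measure Ω) [IsProbabilityMeasure μ]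
    (i : Fin n) (A : Set Ω) (φ : (Fin n → Ω) → ℝ) (ξ : Ω → ℝ)
    (hξA : ∀ ω ∈ A, ξ ω = 0) (hξ : ∫ ω, ξ ω ∂μ = 0)
    (hφ : ∀ d ω ω', ω ∉ A → ω' ∉ A → φ (Function.update d i ω) = φ (Function.update d i ω'))
    (hint : Integrable (fun d => φ d * ξ (d i)) (Measure.pi fun _ : Fin n => μ)) :
    ∫ d, φ d * ξ (d i) ∂(Measure.pi fun _ : Fin n => μ) = 0 := by
  obtain _ | n := n
  · exact i.elim0
  have e := (measurePreserving_piFinSuccAbove (fun _ : Fin (n + 1) => μ) i).symm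
  have key : ∀ p : Ω × (Fin n → Ω),
      (MeasurableEquiv.piFinSuccAbove (fun _ : Fin (n + 1) => Ω) i).symm p
        = i.insertNth p.1 p.2 := fun p => rfl
  rw [← e.integral_comp']
  rw [← e.integrable_comp_emb (MeasurableEquiv.measurableEmbedding _)] at hint
  have hint' : Integrable (fun p : Ω × (Fin n → Ω) => φ (i.insertNth p.1 p.2) *
      ξ (i.insertNth (α := fun _ => Ω) p.1 p.2 i)) (μ.prod (Measure.pi fun _ : Fin n => μ)) := hint
  simp only [key]
  rw [integral_prod_symm _ hint']
  simp only [ Fin.insertNth_apply_same]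
  rw [← integral_zero (Fin n → Ω) ℝ (μ := Measure.pi fun _ : Fin n => μ)]
  congr 1
  funext d'
  by_cases hA : ∃ ω₀, ω₀ ∉ A
  · obtain ⟨ω₀, h₀⟩ := hA
    have : ∀ ω, φ (i.insertNth ω d') * ξ ω = φ (i.insertNth ω₀ d') * ξ ω := by
      intro ω
      by_cases hω : ω ∈ A
      · simp [hξA ω hω]
      · have := hφ (i.insertNth ω d') ω ω₀ hω h₀
        simp only [Fin.update_insertNth] at this
        rw [this]
    simp only [this, integral_const_mul, hξ, mul_zero]
  · push Not at hA
    simp [hξA _ (hA _)]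

theorem integral_pi_sum_sq {n : ℕ} (μ : Measure Ω) [IsProbabilityMeasure μ]
    (g : Ω → ℝ) (hg : Measurable g) (c : ℝ) (hc : ∀ ω, |g ω| ≤ c) (h0 : ∫ ω, g ω ∂μ = 0) :
    ∫ d, (∑ i, g (d i)) ^ 2 ∂(Measure.pi fun _ : Fin n => μ) = n * ∫ ω, g ω ^ 2 ∂μ := by
  have hint : ∀ i j : Fin n, Integrable (fun d : Fin n → Ω => g (d i) * g (d j))
      (Measure.pi fun _ : Fin n => μ) := by
    intro i j
    refine Integrable.of_bound (by fun_prop) (c * c) (ae_of_all _ fun d => ?_)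
    rw [norm_mul]
    exact mul_le_mul (hc _) (hc _) (norm_nonneg _) ((abs_nonneg _).trans (hc (d i)))
  have h1 : ∀ d : Fin n → Ω, (∑ i, g (d i)) ^ 2 = ∑ i, ∑ j, g (d i) * g (d j) := by
    intro d; rw [sq, Finset.sum_mul_sum]
  simp only [h1]
  rw [integral_finsetSum _ fun i _ => integrable_finsetSum _ fun j _ => hint i j]
  have h2 : ∀ i : Fin n, ∫ d, ∑ j, g (d i) * g (d j) ∂(Measure.pi fun _ : Fin n => μ)
      = ∫ ω, g ω ^ 2 ∂μ := by
    intro i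
    rw [integral_finsetSum _ fun j _ => hint i j, Finset.sum_eq_single i]
    · simp only [← sq]
      exact integral_comp_eval (μ := fun _ : Fin n => μ) (i := i) (f := fun ω => g ω ^ 2)
        (by fun_prop)
    · intro j _ hj
      exact integral_pi_mul_eval_eq_zero μ j ∅ (fun d => g (d i)) g (by simp) h0
        (fun d ω ω' _ _ => by simp [Function.update_of_ne hj.symm]) (hint i j)
    · simp
  simp [h2]

/-- First-passage form of Kolmogorov's inequality. -/
theorem measureReal_exists_le_abs_le {D : Type*} [MeasurableSpace D] (P : Measure D)
    [IsFiniteMeasure P] (T : ℕ → D → ℝ) (m : ℕ) (hT : ∀ j, Measurable (T j))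
    (c : ℝ) (hc : ∀ j d, |T j d| ≤ c) (l : ℝ) (hl : 0 < l)
    (horth : ∀ j ≤ m, ∀ E : Set D, MeasurableSet E →
      (∀ d d', (∀ i ≤ j, T i d = T i d') → d ∈ E → d' ∈ E) →
      ∫ d, E.indicator (T j) d * (T m d - T j d) ∂P = 0) :
    P.real {d | ∃ j ≤ m, l ≤ |T j d|} ≤ (∫ d, T m d ^ 2 ∂P) / l ^ 2 := by
  -- `E j` is the event that level l is first reached at time j.
  set E : ℕ → Set D := fun j => {d | l ≤ |T j d| ∧ ∀ i < j, |T i d| < l} with hE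
  have hEm : ∀ j, MeasurableSet (E j) := by
    intro j
    have hE' : E j = {d | l ≤ |T j d|} ∩ ⋂ i ∈ Finset.range j, {d | |T i d| < l} := by
      ext d; simp [hE]
    rw [hE']
    refine (measurableSet_le measurable_const (hT j).abs).inter
      (Finset.measurableSet_biInter _ fun i _ => measurableSet_lt (hT i).abs measurable_const)
  have hcov : {d | ∃ j ≤ m, l ≤ |T j d|} = ⋃ j ∈ Finset.range (m + 1), E j := by
    ext d
    simp only [mem_ofPred_eq, mem_iUnion, Finset.mem_range, hE]
    constructor
    · rintro ⟨j, hj, hlj⟩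
      classical
      have hex : ∃ j, l ≤ |T j d| := ⟨j, hlj⟩
      refine ⟨Nat.find hex, ?_, Nat.find_spec hex, fun i hi => not_le.mp (Nat.find_min hex hi)⟩
      have := Nat.find_min' hex hlj
      omega
    · rintro ⟨j, hj, h1, _⟩
      exact ⟨j, by omega, h1⟩
  have hdisj : Pairwise (Function.onFun Disjoint E) := by
    intro i j hij
    rw [Function.onFun, Set.disjoint_left]
    rintro d ⟨h1, h2⟩ ⟨h3, h4⟩
    rcases lt_or_gt_of_ne hij with h | h
    · exact absurd (h4 i h) (not_lt.mpr h1)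
    · exact absurd (h2 j h) (not_lt.mpr h3)
  have hsum : P.real {d | ∃ j ≤ m, l ≤ |T j d|} = ∑ j ∈ Finset.range (m + 1), P.real (E j) := by
    rw [hcov, measureReal_biUnion_finset (fun i _ j _ hij => hdisj hij) fun j _ => hEm j]
  have hTint : ∀ j, Integrable (fun d => (E j).indicator (T j) d * (T m d - T j d)) P := by
    intro j
    have hc0 : ∀ d, 0 ≤ c := fun d => (abs_nonneg _).trans (hc j d)
    refine Integrable.of_bound
      ((((hT j).indicator (hEm j)).mul ((hT m).sub (hT j))).aestronglyMeasurable)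
      (c * (c + c)) (ae_of_all _ fun d => ?_)
    rw [norm_mul]
    refine mul_le_mul ((norm_indicator_le_norm_self _ _).trans (hc j d)) ?_ (norm_nonneg _) (hc0 d)
    exact (abs_sub _ _).trans (add_le_add (hc m d) (hc j d))
  have hTm : Integrable (fun d => T m d ^ 2) P := by
    refine Integrable.of_bound ((hT m).pow_const 2).aestronglyMeasurable (c ^ 2)
      (ae_of_all _ fun d => ?_)
    rw [norm_pow]
    exact pow_le_pow_left₀ (norm_nonneg _) (hc m d) 2
  -- On `E j`, T_m² ≥ T_j² + 2 T_j (T_m - T_j) and T_j² ≥ l². The cross terms vanish on integration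
  -- by `horth`.
  have hpt : ∀ d, ∑ j ∈ Finset.range (m + 1), ((E j).indicator (fun _ => l ^ 2) d
      + 2 * ((E j).indicator (T j) d * (T m d - T j d))) ≤ T m d ^ 2 := by
    intro d
    by_cases hd : ∃ j ∈ Finset.range (m + 1), d ∈ E j
    · obtain ⟨j, hj, hdj⟩ := hd
      rw [Finset.sum_eq_single_of_mem j hj]
      · rw [indicator_of_mem hdj, indicator_of_mem hdj]
        have h1 : l ^ 2 ≤ T j d ^ 2 := by
          rw [← sq_abs (T j d)]; exact pow_le_pow_left₀ hl.le hdj.1 2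
        nlinarith [sq_nonneg (T m d - T j d)]
      · intro i _ hij
        have : d ∉ E i := fun h => Set.disjoint_left.mp (hdisj hij) h hdj
        simp [this]
    · push Not at hd
      rw [Finset.sum_eq_zero]
      · positivity
      · intro j hj
        simp [hd j hj]
  have hE1 : ∀ j, Integrable ((E j).indicator (fun _ : D => l ^ 2)) P := fun j =>
    (integrable_const _).indicator (hEm j)
  have hadd : ∀ j, Integrable (fun d => (E j).indicator (fun _ => l ^ 2) d
      + 2 * ((E j).indicator (T j) d * (T m d - T j d))) P := fun j =>
    (hE1 j).add ((hTint j).const_mul 2)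
  have := integral_mono (μ := P) (integrable_finsetSum _ fun j _ => hadd j) hTm hpt
  rw [integral_finsetSum _ fun j _ => hadd j] at this
  have h3 : ∀ j ∈ Finset.range (m + 1), ∫ d, ((E j).indicator (fun _ => l ^ 2) d
      + 2 * ((E j).indicator (T j) d * (T m d - T j d))) ∂P = P.real (E j) * l ^ 2 := by
    intro j hj
    rw [integral_add (hE1 j) ((hTint j).const_mul 2), integral_const_mul,
      horth j (by simpa [Nat.lt_succ_iff] using hj) (E j) (hEm j), integral_indicator_const _ (hEm j)]
    · simp
    · rintro d d' hdd' ⟨h1, h2⟩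
      exact ⟨by rw [← hdd' j le_rfl]; exact h1, fun i hi => by rw [← hdd' i hi.le]; exact h2 i hi⟩
  rw [Finset.sum_congr rfl h3, ← Finset.sum_mul, ← hsum] at this
  rwa [le_div_iff₀ (by positivity)]

/-- The number of observations in `A`, minus its expectation. -/
noncomputable def centeredCount (μ : Measure Ω) {n : ℕ} (A : Set Ω) (d : Fin n → Ω) : ℝ :=
  ∑ i, (A.indicator (fun _ => (1 : ℝ)) (d i) - μ.real A)

theorem centeredCount_eq (μ : Measure Ω) {n : ℕ} (A : Set Ω) (d : Fin n → Ω) :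
    centeredCount μ A d = ∑ i, A.indicator (fun _ => (1 : ℝ)) (d i) - n * μ.real A := by
  simp [centeredCount, Finset.sum_sub_distrib]

theorem centeredCount_union (μ : Measure Ω) [IsFiniteMeasure μ] {n : ℕ} {A B : Set Ω}
    (hB : MeasurableSet B) (h : Disjoint A B) (d : Fin n → Ω) :
    centeredCount μ (A ∪ B) d = centeredCount μ A d + centeredCount μ B d := by
  have hr : μ.real (A ∪ B) = μ.real A + μ.real B := measureReal_union h hB
  simp only [centeredCount, ← Finset.sum_add_distrib, hr, indicator_union_of_disjoint h]
  exact Finset.sum_congr rfl fun i _ => by ring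

theorem measurable_centeredCount (μ : Measure Ω) {n : ℕ} {A : Set Ω} (hA : MeasurableSet A) :
    Measurable (centeredCount μ A : (Fin n → Ω) → ℝ) := by
  unfold centeredCount
  refine Finset.measurable_sum _ fun i _ => ?_
  exact ((measurable_const.indicator hA).comp (measurable_pi_apply i)).sub measurable_const

/-- The sums T_j of (1_{A_j} - a_j)/(1 - a_j) form a martingale as A_j grows: a point in A_j
contributes 1 from then on, and a point still outside has the constant value -a_j/(1 - a_j), which
is the conditional mean of its later values. Since a_j ≤ 1/2, the variance a_m/(1 - a_m) of one term
is at most 2 a_m. The centred count is (1 - a_j) T_j, hence no larger than T_j in absolute value. -/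
theorem measureReal_exists_centeredCount_chain {n : ℕ} (μ : Measure Ω) [IsProbabilityMeasure μ]
    (A : ℕ → Set Ω) (hA : ∀ j, MeasurableSet (A j)) (hmono : Monotone A) (m : ℕ)
    (hm : ∀ j, μ.real (A j) ≤ 1 / 2) (l : ℝ) (hl : 0 < l) :
    (Measure.pi fun _ : Fin n => μ).real {d | ∃ j ≤ m, l ≤ |centeredCount μ (A j) d|}
      ≤ 2 * n * μ.real (A m) / l ^ 2 := by
  set a : ℕ → ℝ := fun j => μ.real (A j) with ha
  have ha0 : ∀ j, 0 ≤ a j := fun j => measureReal_nonneg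
  have ha1 : ∀ j, 1 / 2 ≤ 1 - a j := fun j => by have := hm j; simp only [ha]; linarith
  set g : ℕ → Ω → ℝ := fun j ω => ((A j).indicator (fun _ => (1 : ℝ)) ω - a j) / (1 - a j) with hg
  have hind : ∀ j ω, 0 ≤ (A j).indicator (fun _ => (1 : ℝ)) ω ∧
      (A j).indicator (fun _ => (1 : ℝ)) ω ≤ 1 := by
    intro j ω
    by_cases h : ω ∈ A j <;> simp [h]
  have hgm : ∀ j, Measurable (g j) := fun j =>
    ((measurable_const.indicator (hA j)).sub measurable_const).div_const _
  have hgb : ∀ j ω, |g j ω| ≤ 2 := by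
    intro j ω
    simp only [hg]
    rw [abs_div, div_le_iff₀ (abs_pos.mpr (by linarith [ha1 j])), abs_of_pos (a := 1 - a j)
      (by linarith [ha1 j]), abs_le]
    have := hind j ω
    have := ha1 j
    have := ha0 j
    constructor <;> linarith
  have hindint : ∀ j, Integrable ((A j).indicator (fun _ => (1 : ℝ))) μ := fun j =>
    (integrable_const _).indicator (hA j)
  have hg0 : ∀ j, ∫ ω, g j ω ∂μ = 0 := by
    intro j
    simp only [hg]
    rw [integral_div, integral_sub (hindint j) (integrable_const _),
      integral_indicator_const _ (hA j)]
    simp [ha]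
  have hgint : ∀ j, Integrable (g j) μ := fun j =>
    ((hindint j).sub (integrable_const _)).div_const _
  have hg1 : ∀ j, ∀ ω ∈ A j, g j ω = 1 := by
    intro j ω hω
    simp only [hg, indicator_of_mem hω]
    exact div_self (by linarith [ha1 j])
  have hgc : ∀ j, ∀ ω ∉ A j, g j ω = - a j / (1 - a j) := by
    intro j ω hω
    simp only [hg, indicator_of_notMem hω, zero_sub]
  have hgsq : ∀ j, ∫ ω, g j ω ^ 2 ∂μ ≤ 2 * a j := by
    intro j
    have h1 : ∀ ω, g j ω ^ 2 = ((1 - 2 * a j) / (1 - a j) ^ 2) *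
        (A j).indicator (fun _ => (1 : ℝ)) ω + a j ^ 2 / (1 - a j) ^ 2 := by
      intro ω
      have := ha1 j
      by_cases h : ω ∈ A j
      · rw [hg1 j ω h, indicator_of_mem h]
        field_simp [show (1 - a j) ≠ 0 by linarith]
        ring
      · rw [hgc j ω h, indicator_of_notMem h]
        rw [div_pow]; ring
    simp only [h1]
    rw [integral_add ((hindint j).const_mul _) (integrable_const _), integral_const_mul,
      integral_indicator_const _ (hA j)]
    simp only [smul_eq_mul, mul_one, integral_const, probReal_univ, one_mul]
    change (1 - 2 * a j) / (1 - a j) ^ 2 * a j + a j ^ 2 / (1 - a j) ^ 2 ≤ 2 * a j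
    have h2 := ha1 j
    have h3 := ha0 j
    have : (1 - 2 * a j) / (1 - a j) ^ 2 * a j + a j ^ 2 / (1 - a j) ^ 2 = a j / (1 - a j) := by
      field_simp [show (1 - a j) ≠ 0 by linarith]; ring
    rw [this, div_le_iff₀ (by linarith)]
    nlinarith
  set T : ℕ → (Fin n → Ω) → ℝ := fun j d => ∑ i, g j (d i) with hT
  have hTc : ∀ j d, centeredCount μ (A j) d = (1 - a j) * T j d := by
    intro j d
    simp only [hT, centeredCount, Finset.mul_sum, hg]
    refine Finset.sum_congr rfl fun i _ => ?_
    rw [mul_div_cancel₀ _ (show (1 - a j) ≠ 0 by linarith [ha1 j])]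
  have hTm : ∀ j, Measurable (T j) := fun j =>
    Finset.measurable_sum _ fun i _ => (hgm j).comp (measurable_pi_apply i)
  have hTb : ∀ j d, |T j d| ≤ n * 2 := by
    intro j d
    refine (Finset.abs_sum_le_sum_abs _ _).trans ?_
    refine (Finset.sum_le_sum fun i _ => hgb j (d i)).trans ?_
    simp
  have hkol := measureReal_exists_le_abs_le (Measure.pi fun _ : Fin n => μ) T m hTm (n * 2) hTb l hl
    (by
      intro j hj E hEm hE
      have hEint : ∀ i, Integrable
          (fun d => E.indicator (T j) d * (g m (d i) - g j (d i)))
          (Measure.pi fun _ : Fin n => μ) := by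
        intro i
        refine Integrable.of_bound
          ((((hTm j).indicator hEm).mul (((hgm m).comp (measurable_pi_apply i)).sub
            ((hgm j).comp (measurable_pi_apply i)))).aestronglyMeasurable)
          (n * 2 * (2 + 2)) (ae_of_all _ fun d => ?_)
        rw [norm_mul]
        refine mul_le_mul ((norm_indicator_le_norm_self _ _).trans (hTb j d)) ?_ (norm_nonneg _)
          (by positivity)
        exact (abs_sub _ _).trans (add_le_add (hgb m _) (hgb j _))
      have h1 : ∀ d, E.indicator (T j) d * (T m d - T j d)
          = ∑ i, E.indicator (T j) d * (g m (d i) - g j (d i)) := by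
        intro d
        simp only [hT, ← Finset.mul_sum, ← Finset.sum_sub_distrib]
      simp only [h1]
      rw [integral_finsetSum _ fun i _ => hEint i]
      refine Finset.sum_eq_zero fun i _ => ?_
      refine integral_pi_mul_eval_eq_zero μ i (A j) (E.indicator (T j))
        (fun ω => g m ω - g j ω) ?_ ?_ ?_ (hEint i)
      · intro ω hω
        rw [hg1 m ω (hmono hj hω), hg1 j ω hω, sub_self]
      · rw [integral_sub (hgint m) (hgint j), hg0, hg0, sub_self]
      -- For k ≤ j the function `g k` is constant off `A j`, so moving coordinate i there changes
      -- none of T_0, …, T_j, nor membership of E.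
      · intro d ω ω' hω hω'
        have hTeq : ∀ k ≤ j, T k (Function.update d i ω) = T k (Function.update d i ω') := by
          intro k hk
          simp only [hT]
          refine Finset.sum_congr rfl fun i' _ => ?_
          by_cases hi : i' = i
          · subst hi
            simp only [Function.update_self]
            rw [hgc k ω fun h => hω (hmono hk h), hgc k ω' fun h => hω' (hmono hk h)]
          · simp only [Function.update_of_ne hi]
        by_cases h : Function.update d i ω ∈ E
        · rw [indicator_of_mem h, indicator_of_mem (hE _ _ hTeq h), hTeq j le_rfl]
        · rw [indicator_of_notMem h, indicator_of_notMem
            fun h' => h (hE _ _ (fun k hk => (hTeq k hk).symm) h')])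
  calc _ ≤ (Measure.pi fun _ : Fin n => μ).real {d | ∃ j ≤ m, l ≤ |T j d|} := by
        refine measureReal_mono ?_
        rintro d ⟨j, hj, h⟩
        refine ⟨j, hj, h.trans ?_⟩
        rw [hTc, abs_mul]
        have := ha1 j
        have h2 := ha0 j
        rw [abs_of_pos (by linarith)]
        exact mul_le_of_le_one_left (abs_nonneg _) (by linarith)
    _ ≤ _ := hkol
    _ ≤ _ := by
        have : ∫ d, T m d ^ 2 ∂(Measure.pi fun _ : Fin n => μ) = _ :=
          integral_pi_sum_sq (n := n) μ (g m) (hgm m) 2 (hgb m) (hg0 m)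
        rw [this]
        refine div_le_div_of_nonneg_right ?_ (by positivity)
        calc (n : ℝ) * ∫ ω, g m ω ^ 2 ∂μ ≤ n * (2 * a m) :=
              mul_le_mul_of_nonneg_left (hgsq m) (by positivity)
          _ = _ := by ring

theorem measureReal_centeredCount_le {n : ℕ} (μ : Measure Ω) [IsProbabilityMeasure μ]
    {A : Set Ω} (hA : MeasurableSet A) (l : ℝ) (hl : 0 < l) :
    (Measure.pi fun _ : Fin n => μ).real {d | l ≤ |centeredCount μ A d|}
      ≤ n * μ.real A / l ^ 2 := by
  set g : Ω → ℝ := fun ω => A.indicator (fun _ => (1 : ℝ)) ω - μ.real A with hg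
  have hind : Integrable (A.indicator (fun _ => (1 : ℝ))) μ := (integrable_const _).indicator hA
  have hgm : Measurable g := (measurable_const.indicator hA).sub measurable_const
  have ha0 : 0 ≤ μ.real A := measureReal_nonneg
  have ha1 : μ.real A ≤ 1 := measureReal_le_one
  have hgb : ∀ ω, |g ω| ≤ 1 := by
    intro ω
    by_cases h : ω ∈ A <;> simp [hg, h, abs_le] <;> linarith
  have hg0 : ∫ ω, g ω ∂μ = 0 := by
    simp only [hg]
    rw [integral_sub hind (integrable_const _), integral_indicator_const _ hA]
    simp
  have hsq : ∫ ω, g ω ^ 2 ∂μ ≤ μ.real A := by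
    have h1 : ∀ ω, g ω ^ 2 = (1 - 2 * μ.real A) * A.indicator (fun _ => (1 : ℝ)) ω
        + μ.real A ^ 2 := by
      intro ω
      by_cases h : ω ∈ A <;> simp [hg, h]
      ring
    simp only [h1]
    rw [integral_add (hind.const_mul _) (integrable_const _), integral_const_mul,
      integral_indicator_const _ hA]
    simp
    nlinarith
  -- With a single time, Kolmogorov's inequality is Chebyshev's and the orthogonality is trivial.
  have hkol := measureReal_exists_le_abs_le (Measure.pi fun _ : Fin n => μ)
    (fun _ d => centeredCount μ A d) 0 (fun _ => measurable_centeredCount μ hA) (n * 1)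
    (fun _ d => by
      refine (Finset.abs_sum_le_sum_abs _ _).trans ?_
      refine (Finset.sum_le_sum fun i _ => hgb (d i)).trans ?_
      simp) l hl (by simp)
  refine le_trans (measureReal_mono (s₂ := {d | ∃ j ≤ 0, l ≤ |centeredCount μ A d|})
    fun d hd => ⟨0, le_rfl, hd⟩) (hkol.trans ?_)
  refine div_le_div_of_nonneg_right ?_ (by positivity)
  have : ∫ d, centeredCount μ A d ^ 2 ∂(Measure.pi fun _ : Fin n => μ) = _ :=
    integral_pi_sum_sq (n := n) μ g hgm 1 hgb hg0
  rw [this]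
  exact mul_le_mul_of_nonneg_left hsq (by positivity)

end MaximalInequality

/-! ### From counts to the cube-root rate -/

section ERM

variable {Ω : Type*} [MeasurableSpace Ω]

/-- Passage from a grid to the continuum. The mesh is so fine that a cell holds at most l
observations on average. Counts are monotone, so an excess of 2l at s leaves an excess of l at the
grid point to the right, and a deficit of 2l leaves a deficit of l at the one to the left. -/
theorem measureReal_exists_centeredCount_of_le_half {n : ℕ} (μ : Measure Ω)
    [IsProbabilityMeasure μ] (A : ℝ → Set Ω) (hA : ∀ s, MeasurableSet (A s)) (hmono : Monotone A)
    {D κ : ℝ} (hD : 0 ≤ D)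
    (hlip : ∀ s t, 0 ≤ s → s ≤ t → t ≤ D → μ.real (A t) - μ.real (A s) ≤ κ * (t - s))
    (hhalf : μ.real (A D) ≤ 1 / 2) {l : ℝ} (hl : 0 < l) :
    (Measure.pi fun _ : Fin n => μ).real {d | ∃ s ∈ Icc 0 D, 2 * l ≤ |centeredCount μ (A s) d|}
      ≤ 2 * n * μ.real (A D) / l ^ 2 := by
  obtain ⟨m, hm⟩ := exists_nat_gt (max 0 (n * κ * D / l))
  have hm0 : (0 : ℝ) < m := (le_max_left _ _).trans_lt hm
  have hml : n * κ * D / l < m := (le_max_right _ _).trans_lt hm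
  set w : ℝ := D / m with hw
  have hw0 : 0 ≤ w := by positivity
  have hnw : n * (κ * w) ≤ l := by
    rw [div_lt_iff₀ hl] at hml
    rw [hw, ← mul_div_assoc, ← mul_div_assoc, div_le_iff₀ hm0]
    linarith
  -- Truncation at D keeps every set of the chain below mass 1/2. The chain runs to m + 1 because s
  -- = D can have m as its left index.
  set t : ℕ → ℝ := fun j => min (j * w) D with ht
  have htmono : Monotone t := fun i j hij =>
    min_le_min_right _ (mul_le_mul_of_nonneg_right (by exact_mod_cast hij) hw0)
  have ht0 : ∀ j, 0 ≤ t j := fun j => le_min (by positivity) hD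
  have htD : ∀ j, t j ≤ D := fun j => min_le_right _ _
  have htm : t (m + 1) = D := by
    simp only [ht]
    rw [min_eq_right]
    have : (m : ℝ) * w = D := by rw [hw]; field_simp
    push_cast
    linarith
  have hchain := measureReal_exists_centeredCount_chain (n := n) μ (fun j => A (t j))
    (fun j => hA _) (fun i j hij => hmono (htmono hij)) (m + 1)
    (fun j => (measureReal_mono (hmono (htD j))).trans hhalf) l hl
  rw [htm] at hchain
  refine le_trans (measureReal_mono ?_) hchain
  rintro d ⟨s, ⟨hs0, hsD⟩, hs⟩
  have hj : ∃ j ≤ m, t j ≤ s ∧ s ≤ t (j + 1) ∧ t (j + 1) - t j ≤ w := by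
    have hstep : ∀ j, t (j + 1) - t j ≤ w := by
      intro j
      simp only [ht]
      push_cast
      rcases le_total ((j : ℝ) * w) D with h | h
      · rw [min_eq_left h]
        have := min_le_left (((j : ℝ) + 1) * w) D
        linarith
      · rw [min_eq_right h]
        have := min_le_right (((j : ℝ) + 1) * w) D
        linarith
    rcases hw0.eq_or_lt with h | h
    · have hD' : D = 0 := by
        have : w * m = D := by rw [hw]; field_simp
        rw [← this, ← h, zero_mul]
      exact ⟨0, Nat.zero_le _, (htD 0).trans (by linarith), by linarith [ht0 (0 + 1)], hstep 0⟩
    · refine ⟨⌊s / w⌋₊, ?_, ?_, ?_, hstep _⟩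
      · refine Nat.floor_le_of_le ?_
        rw [div_le_iff₀ h, hw]
        field_simp
        linarith
      · refine (min_le_left _ _).trans ?_
        have := Nat.floor_le (div_nonneg hs0 hw0)
        rwa [le_div_iff₀ h] at this
      · refine le_min ?_ hsD
        have := (Nat.lt_floor_add_one (s / w)).le
        rw [div_le_iff₀ h] at this
        exact_mod_cast this
  obtain ⟨j, hjm, hj1, hj2, hj3⟩ := hj
  have hN : ∀ u v, u ≤ v → ∑ i, (A u).indicator (fun _ => (1 : ℝ)) (d i)
      ≤ ∑ i, (A v).indicator (fun _ => (1 : ℝ)) (d i) := fun u v huv =>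
    Finset.sum_le_sum fun i _ => indicator_le_indicator_of_subset (hmono huv) (fun _ => zero_le_one) _
  have h1 := hN _ _ hj1
  have h2 := hN _ _ hj2
  have ha : μ.real (A (t (j + 1))) - μ.real (A (t j)) ≤ κ * w := by
    rcases le_or_gt 0 κ with h | h
    · exact (hlip _ _ (ht0 j) (htmono (Nat.le_succ j)) (htD _)).trans
        (mul_le_mul_of_nonneg_left hj3 h)
    -- A negative κ is compatible with monotonicity only if D = 0.
    · have h3 := hlip _ _ (le_refl 0) hD le_rfl
      have h4 : μ.real (A 0) ≤ μ.real (A D) := measureReal_mono (hmono hD)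
      have h5 : D = 0 := by nlinarith
      have h6 : ∀ k, t k = 0 := fun k => le_antisymm (h5 ▸ htD k) (ht0 k)
      have h7 : w = 0 := by rw [hw, h5, zero_div]
      rw [h6, h6, h7, sub_self, mul_zero]
  have ha1 : μ.real (A (t j)) ≤ μ.real (A s) := measureReal_mono (hmono hj1)
  have ha2 : μ.real (A s) ≤ μ.real (A (t (j + 1))) := measureReal_mono (hmono hj2)
  by_contra hcon
  have hc : ∀ k ≤ m + 1, |centeredCount μ (A (t k)) d| < l := by
    intro k hk
    by_contra h
    exact hcon ⟨k, hk, not_lt.mp h⟩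
  have hc1 := abs_lt.mp (hc j (by omega))
  have hc2 := abs_lt.mp (hc (j + 1) (by omega))
  rw [centeredCount_eq] at hc1 hc2 hs
  have hna : (n : ℝ) * (μ.real (A (t (j + 1))) - μ.real (A (t j))) ≤ l :=
    (mul_le_mul_of_nonneg_left ha (by positivity)).trans hnw
  have hn1 := mul_le_mul_of_nonneg_left ha1 (Nat.cast_nonneg (α := ℝ) n)
  have hn2 := mul_le_mul_of_nonneg_left ha2 (Nat.cast_nonneg (α := ℝ) n)
  rcases le_abs.mp hs with h | h <;> linarith [hc1.1, hc1.2, hc2.1, hc2.2]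

/-- Maximal inequality for centred counts along an increasing family of events. -/
theorem measureReal_exists_centeredCount {n : ℕ} (μ : Measure Ω)
    [IsProbabilityMeasure μ] (A : ℝ → Set Ω) (hA : ∀ s, MeasurableSet (A s)) (hmono : Monotone A)
    {D κ : ℝ} (hD : 0 ≤ D) (hA0 : μ.real (A 0) = 0)
    (hlip : ∀ s t, 0 ≤ s → s ≤ t → t ≤ D → μ.real (A t) - μ.real (A s) ≤ κ * (t - s))
    {l : ℝ} (hl : 0 < l) :
    (Measure.pi fun _ : Fin n => μ).real {d | ∃ s ∈ Icc 0 D, l ≤ |centeredCount μ (A s) d|}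
      ≤ 32 * n * μ.real (A D) / l ^ 2 := by
  have hcont : ContinuousOn (fun s => μ.real (A s)) (Icc 0 D) := by
    refine LipschitzOnWith.continuousOn (K := κ.toNNReal) ?_
    refine LipschitzOnWith.of_dist_le_mul fun s hs t ht => ?_
    rw [Real.dist_eq, Real.dist_eq]
    wlog hst : s ≤ t generalizing s t
    · rw [abs_sub_comm, abs_sub_comm s t]
      exact this t ht s hs (le_of_not_ge hst)
    rw [abs_sub_comm, abs_sub_comm s t, abs_of_nonneg (sub_nonneg.mpr hst), abs_of_nonneg
      (sub_nonneg.mpr (measureReal_mono (hmono hst)))]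
    exact (hlip s t hs.1 hst ht.2).trans
      (mul_le_mul_of_nonneg_right (Real.le_coe_toNNReal κ) (by linarith))
  have hAD : 0 ≤ μ.real (A D) := measureReal_nonneg
  have hAD1 : μ.real (A D) ≤ 1 := measureReal_le_one
  -- Cutting at half the mass gives two increasing families, up to c and beyond c, each of mass at
  -- most 1/2. A deviation l forces l/2 in one of them; each contributes 16 to the constant 32.
  obtain ⟨c, ⟨hc0, hcD⟩, hc⟩ : μ.real (A D) / 2 ∈ (fun s => μ.real (A s)) '' Icc 0 D :=
    intermediate_value_Icc hD hcont ⟨by rw [hA0]; positivity, by linarith⟩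
  simp only at hc
  have hdiff : ∀ u, 0 ≤ u → μ.real (A (c + u) \ A c) = μ.real (A (c + u)) - μ.real (A c) := by
    intro u hu
    exact measureReal_sdiff (hmono (by linarith)) (hA c)
  have h1 := measureReal_exists_centeredCount_of_le_half (n := n) μ A hA hmono hc0
    (fun s t h0 hst ht => hlip s t h0 hst (ht.trans hcD)) (by rw [hc]; linarith)
    (l := l / 4) (by positivity)
  have hD' : μ.real (A (c + (D - c)) \ A c) = μ.real (A D) / 2 := by
    rw [hdiff _ (by linarith), hc, show c + (D - c) = D by ring]; ring
  have h2 := measureReal_exists_centeredCount_of_le_half (n := n) μ (fun u => A (c + u) \ A c)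
    (fun s => (hA _).diff (hA c))
    (fun u v huv => sdiff_subset_sdiff_left (hmono (by linarith))) (D := D - c) (by linarith)
    (κ := κ)
    (fun s t h0 hst ht => by
      rw [hdiff s h0, hdiff t (h0.trans hst)]
      have := hlip (c + s) (c + t) (by linarith) (by linarith) (by linarith)
      linarith) (by rw [hD']; linarith)
    (l := l / 4) (by positivity)
  rw [hc] at h1
  rw [hD'] at h2
  have hsub : {d : Fin n → Ω | ∃ s ∈ Icc 0 D, l ≤ |centeredCount μ (A s) d|} ⊆
      {d | ∃ s ∈ Icc 0 c, 2 * (l / 4) ≤ |centeredCount μ (A s) d|} ∪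
      {d | ∃ s ∈ Icc 0 (D - c), 2 * (l / 4) ≤ |centeredCount μ (A (c + s) \ A c) d|} := by
    rintro d ⟨s, ⟨hs0, hsD⟩, hs⟩
    rcases le_total s c with h | h
    · exact Or.inl ⟨s, ⟨hs0, h⟩, by linarith⟩
    · have hsplit : centeredCount μ (A s) d
          = centeredCount μ (A c) d + centeredCount μ (A (c + (s - c)) \ A c) d := by
        rw [← centeredCount_union μ ((hA _).diff (hA c)) disjoint_sdiff_right,
          union_sdiff_cancel (hmono (by linarith)), show c + (s - c) = s by ring]
      rw [hsplit] at hs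
      have := hs.trans (abs_add_le _ _)
      by_cases h3 : l / 2 ≤ |centeredCount μ (A c) d|
      · exact Or.inl ⟨c, ⟨hc0, le_rfl⟩, by linarith⟩
      · exact Or.inr ⟨s - c, ⟨by linarith, by linarith⟩, by push Not at h3; linarith⟩
  refine (measureReal_mono hsub).trans ((measureReal_union_le _ _).trans ?_)
  refine (add_le_add h1 h2).trans (le_of_eq ?_)
  field_simp
  ring

/-- Peeling at the scale h = N^(-1/3), where N h³ = 1. The shell at 2^j h contributes at most 2 ·
2^j h · C/8^j = 2Ch/4^j, and these sum to at most 8Ch/3. As X ≤ 1, finitely many shells suffice. -/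
theorem integral_le_of_dyadic_tail {D : Type*} [MeasurableSpace D] (P : Measure D)
    [IsProbabilityMeasure P] (X : D → ℝ) (hX : Measurable X) (h0 : ∀ d, 0 ≤ X d)
    (h1 : ∀ d, X d ≤ 1) {N C : ℝ} (hN : 0 < N) (hC : 0 ≤ C)
    (htail : ∀ δ, 0 < δ → P.real {d | δ ≤ X d ∧ X d ≤ 2 * δ} ≤ C / (N * δ ^ 3)) :
    ∫ d, X d ∂P ≤ (1 + 3 * C) * N ^ (-(1 / 3) : ℝ) := by
  set h : ℝ := N ^ (-(1 / 3) : ℝ) with hh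
  have hh0 : 0 < h := Real.rpow_pos_of_pos hN _
  have hNh : N * h ^ 3 = 1 := by
    rw [hh, ← Real.rpow_natCast, ← Real.rpow_mul hN.le]
    norm_num
    rw [Real.rpow_neg_one]
    exact mul_inv_cancel₀ hN.ne'
  obtain ⟨J, hJ⟩ := pow_unbounded_of_one_lt (1 / h) (one_lt_two (α := ℝ))
  rw [div_lt_iff₀ hh0] at hJ
  set E : ℕ → Set D := fun j => {d | 2 ^ j * h ≤ X d ∧ X d ≤ 2 * (2 ^ j * h)} with hE
  have hEm : ∀ j, MeasurableSet (E j) := fun j =>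
    (measurableSet_le measurable_const hX).inter (measurableSet_le hX measurable_const)
  have hEint : ∀ j, Integrable ((E j).indicator fun _ => 2 * (2 ^ j * h)) P := fun j =>
    (integrable_const _).indicator (hEm j)
  have hpt : ∀ d, X d ≤ h + ∑ j ∈ Finset.range J, (E j).indicator (fun _ => 2 * (2 ^ j * h)) d := by
    intro d
    have hnn : ∀ j ∈ Finset.range J, 0 ≤ (E j).indicator (fun _ => 2 * (2 ^ j * h)) d :=
      fun j _ => indicator_nonneg (fun _ _ => by positivity) _
    rcases lt_or_ge (X d) h with hlt | hge
    · have := Finset.sum_nonneg hnn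
      linarith
    · obtain ⟨j, hj1, hj2⟩ := exists_nat_pow_near (x := X d / h) (y := (2 : ℝ))
        (by rwa [le_div_iff₀ hh0, one_mul]) one_lt_two
      rw [le_div_iff₀ hh0] at hj1
      rw [div_lt_iff₀ hh0, pow_succ] at hj2
      have hjJ : j < J := by
        have : (2 : ℝ) ^ j * h < 2 ^ J * h := hj1.trans_lt ((h1 d).trans_lt hJ)
        exact (pow_lt_pow_iff_right₀ one_lt_two).mp (lt_of_mul_lt_mul_right this hh0.le)
      have hmem : d ∈ E j := ⟨hj1, by linarith⟩
      have := Finset.single_le_sum hnn (Finset.mem_range.mpr hjJ)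
      rw [indicator_of_mem hmem] at this
      linarith
  have hXint : Integrable X P := by
    refine Integrable.of_bound hX.aestronglyMeasurable 1 (ae_of_all _ fun d => ?_)
    rw [Real.norm_eq_abs, abs_of_nonneg (h0 d)]
    exact h1 d
  have hmono := integral_mono hXint ((integrable_const h).add
    (integrable_finsetSum (Finset.range J) fun j _ => hEint j)) hpt
  refine hmono.trans ?_
  rw [integral_add' (integrable_const h) (integrable_finsetSum _ fun j _ => hEint j),
    integral_finsetSum _ fun j _ => hEint j]
  have hterm : ∀ j ∈ Finset.range J, ∫ d, (E j).indicator (fun _ => 2 * (2 ^ j * h)) d ∂P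
      ≤ 2 * C * h * (1 / 4) ^ j := by
    intro j _
    rw [integral_indicator_const _ (hEm j), smul_eq_mul]
    have ht := htail (2 ^ j * h) (by positivity)
    have h8 : N * (2 ^ j * h) ^ 3 = (2 ^ j) ^ 3 := by rw [mul_pow]; linear_combination (2 ^ j) ^ 3 * hNh
    rw [h8] at ht
    refine (mul_le_mul_of_nonneg_right ht (by positivity)).trans (le_of_eq ?_)
    have h4 : (1 / 4 : ℝ) ^ j = 1 / (2 ^ j) ^ 2 := by
      rw [one_div_pow, ← pow_mul, mul_comm j 2, pow_mul]; norm_num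
    rw [h4]
    field_simp
  have hgeom : ∑ j ∈ Finset.range J, (1 / 4 : ℝ) ^ j ≤ 4 / 3 := by
    rw [geom_sum_eq (by norm_num)]
    have : (0 : ℝ) ≤ (1 / 4) ^ J := by positivity
    rw [div_le_iff_of_neg (by norm_num)]
    linarith
  have hs := Finset.sum_le_sum hterm
  rw [← Finset.mul_sum] at hs
  have := mul_le_mul_of_nonneg_left hgeom (show 0 ≤ 2 * C * h by positivity)
  simp only [integral_const, probReal_univ, one_smul]
  have : 0 ≤ C * h := by positivity
  linarith

/-- Cube-root convergence of the maximizer of the empirical revenue `p * #{i : d i ∈ B, p ≤ Y}`. -/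
theorem integral_abs_erm_sub_le {n : ℕ} (hn : 1 ≤ n) (μ : Measure Ω) [IsProbabilityMeasure μ]
    {B : Set Ω} (hB : MeasurableSet B) {Y : Ω → ℝ} (hY : Measurable Y) {M q c p₀ : ℝ}
    (hM : 0 ≤ M) (hq : 0 < q) (hc : 0 < c) (hBq : μ.real B ≤ q)
    (hlip : ∀ a b, a ≤ b → μ.real (B ∩ {ω | a ≤ Y ω ∧ Y ω < b}) ≤ M * q * (b - a))
    (hp₀ : p₀ ∈ Icc (0 : ℝ) 1)
    (hquad : ∀ p ∈ Icc (0 : ℝ) 1, c * q * (p - p₀) ^ 2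
      ≤ p₀ * μ.real (B ∩ {ω | p₀ ≤ Y ω}) - p * μ.real (B ∩ {ω | p ≤ Y ω}))
    {π : (Fin n → Ω) → ℝ} (hπ : Measurable π) (hmem : ∀ d, π d ∈ Icc (0 : ℝ) 1)
    (hmax : ∀ d, p₀ * ∑ i, (B ∩ {ω | p₀ ≤ Y ω}).indicator (fun _ => (1 : ℝ)) (d i)
      ≤ π d * ∑ i, (B ∩ {ω | π d ≤ Y ω}).indicator (fun _ => (1 : ℝ)) (d i)) :
    ∫ d, |π d - p₀| ∂(Measure.pi fun _ : Fin n => μ)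
      ≤ (1 + 3 * ((512 * M + 16) / c ^ 2)) * (n * q) ^ (-(1 / 3) : ℝ) := by
  have hn0 : (0 : ℝ) < n := by exact_mod_cast hn
  refine integral_le_of_dyadic_tail _ (fun d => |π d - p₀|) (hπ.sub measurable_const).abs
    (fun d => abs_nonneg _) (fun d => ?_) (by positivity) (by positivity) ?_
  · have := hmem d
    rw [abs_le]; constructor <;> linarith [this.1, this.2, hp₀.1, hp₀.2]
  intro δ hδ
  rcases lt_or_ge 1 δ with hδ1 | hδ1
  · have : {d : Fin n → Ω | δ ≤ |π d - p₀| ∧ |π d - p₀| ≤ 2 * δ} = ∅ := by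
      ext d
      simp only [mem_ofPred_eq, mem_empty_iff_false, iff_false, not_and]
      intro h
      have := hmem d
      have : |π d - p₀| ≤ 1 := by
        rw [abs_le]; constructor <;> linarith [this.1, this.2, hp₀.1, hp₀.2]
      linarith
    rw [this, measureReal_empty]
    positivity
  set up : ℝ → Set Ω := fun s => B ∩ {ω | p₀ ≤ Y ω ∧ Y ω < p₀ + s} with hup
  set dn : ℝ → Set Ω := fun s => B ∩ {ω | p₀ - s ≤ Y ω ∧ Y ω < p₀} with hdn
  have hIco : ∀ a b, MeasurableSet (B ∩ {ω | a ≤ Y ω ∧ Y ω < b}) := fun a b =>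
    hB.inter ((measurableSet_le measurable_const hY).inter (measurableSet_lt hY measurable_const))
  have hIci : ∀ a, MeasurableSet (B ∩ {ω | a ≤ Y ω}) := fun a =>
    hB.inter (measurableSet_le measurable_const hY)
  have hupmono : Monotone up := fun s t hst =>
    inter_subset_inter_right _ fun ω hω => ⟨hω.1, hω.2.trans_le (by linarith)⟩
  have hdnmono : Monotone dn := fun s t hst =>
    inter_subset_inter_right _ fun ω hω => ⟨le_trans (by linarith) hω.1, hω.2⟩
  have hup0 : up 0 = ∅ := by
    ext ω; simp only [hup, mem_inter_iff, mem_ofPred_eq, mem_empty_iff_false, iff_false]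
    rintro ⟨_, h1, h2⟩; linarith
  have hdn0 : dn 0 = ∅ := by
    ext ω; simp only [hdn, mem_inter_iff, mem_ofPred_eq, mem_empty_iff_false, iff_false]
    rintro ⟨_, h1, h2⟩; linarith
  -- On the shell the quadratic loss is at least n c q δ². Half of it is allotted to the change of
  -- the centred count, and half to the centred count at p₀ times the price change 2δ, whence the
  -- threshold n c q δ/4 there.
  have hl : 0 < n * c * q * δ ^ 2 / 2 := by positivity
  have hU := measureReal_exists_centeredCount (n := n) μ up (fun s => hIco _ _) hupmono
    (D := 2 * δ) (κ := M * q) (by positivity) (by rw [hup0, measureReal_empty])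
    (fun s t hs hst _ => by
      rw [← measureReal_sdiff (hupmono hst) (hIco _ _)]
      refine (measureReal_mono ?_).trans ((hlip (p₀ + s) (p₀ + t) (by linarith)).trans
        (le_of_eq (by ring)))
      rintro ω ⟨⟨h1, h2, h3⟩, h4⟩
      refine ⟨h1, ?_, h3⟩
      by_contra h
      exact h4 ⟨h1, h2, not_le.mp h⟩) hl
  have hDn := measureReal_exists_centeredCount (n := n) μ dn (fun s => hIco _ _) hdnmono
    (D := 2 * δ) (κ := M * q) (by positivity) (by rw [hdn0, measureReal_empty])
    (fun s t hs hst _ => by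
      rw [← measureReal_sdiff (hdnmono hst) (hIco _ _)]
      refine (measureReal_mono ?_).trans ((hlip (p₀ - t) (p₀ - s) (by linarith)).trans
        (le_of_eq (by ring)))
      rintro ω ⟨⟨h1, h2, h3⟩, h4⟩
      refine ⟨h1, h2, ?_⟩
      by_contra h
      exact h4 ⟨h1, not_lt.mp h, h3⟩) hl
  have hCh := measureReal_centeredCount_le (n := n) μ (hIci p₀) (n * c * q * δ / 4) (by positivity)
  have hupD : μ.real (up (2 * δ)) ≤ M * q * (2 * δ) :=
    (hlip p₀ (p₀ + 2 * δ) (by linarith)).trans (le_of_eq (by ring))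
  have hdnD : μ.real (dn (2 * δ)) ≤ M * q * (2 * δ) :=
    (hlip (p₀ - 2 * δ) p₀ (by linarith)).trans (le_of_eq (by ring))
  have hp₀q : μ.real (B ∩ {ω | p₀ ≤ Y ω}) ≤ q := (measureReal_mono inter_subset_left).trans hBq
  have hsub : {d : Fin n → Ω | δ ≤ |π d - p₀| ∧ |π d - p₀| ≤ 2 * δ} ⊆
      ({d | ∃ s ∈ Icc 0 (2 * δ), n * c * q * δ ^ 2 / 2 ≤ |centeredCount μ (up s) d|} ∪
      {d | ∃ s ∈ Icc 0 (2 * δ), n * c * q * δ ^ 2 / 2 ≤ |centeredCount μ (dn s) d|}) ∪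
      {d | n * c * q * δ / 4 ≤ |centeredCount μ (B ∩ {ω | p₀ ≤ Y ω}) d|} := by
    rintro d ⟨hd1, hd2⟩
    by_contra hcon
    simp only [mem_union, mem_ofPred_eq, not_or, not_exists, not_and, not_le] at hcon
    obtain ⟨⟨hcu, hcd⟩, hc0⟩ := hcon
    set S0 := centeredCount μ (B ∩ {ω | p₀ ≤ Y ω}) d with hS0
    set Sp := centeredCount μ (B ∩ {ω | π d ≤ Y ω}) d with hSp
    have hdiff : |Sp - S0| < n * c * q * δ ^ 2 / 2 := by
      rcases le_total p₀ (π d) with h | h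
      · have hx : |π d - p₀| = π d - p₀ := abs_of_nonneg (by linarith)
        have hun : B ∩ {ω | p₀ ≤ Y ω} = up (π d - p₀) ∪ (B ∩ {ω | π d ≤ Y ω}) := by
          ext ω
          simp only [hup, mem_inter_iff, mem_ofPred_eq, mem_union]
          constructor
          · rintro ⟨h1, h2⟩
            rcases lt_or_ge (Y ω) (π d) with h3 | h3
            · exact Or.inl ⟨h1, h2, by linarith⟩
            · exact Or.inr ⟨h1, h3⟩
          · rintro (⟨h1, h2, _⟩ | ⟨h1, h2⟩)
            · exact ⟨h1, h2⟩
            · exact ⟨h1, h.trans h2⟩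
        have hdis : Disjoint (up (π d - p₀)) (B ∩ {ω | π d ≤ Y ω}) := by
          rw [Set.disjoint_left]
          rintro ω ⟨_, _, h2⟩ ⟨_, h3⟩
          simp only [mem_ofPred_eq] at h3
          linarith
        have := centeredCount_union μ (hIci (π d)) hdis d
        rw [← hun] at this
        rw [hSp, hS0, this, sub_add_cancel_right, abs_neg]
        exact hcu _ ⟨by linarith, by linarith⟩
      · have hx : |π d - p₀| = p₀ - π d := by rw [abs_sub_comm]; exact abs_of_nonneg (by linarith)
        have hun : B ∩ {ω | π d ≤ Y ω} = dn (p₀ - π d) ∪ (B ∩ {ω | p₀ ≤ Y ω}) := by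
          ext ω
          simp only [hdn, mem_inter_iff, mem_ofPred_eq, mem_union]
          constructor
          · rintro ⟨h1, h2⟩
            rcases lt_or_ge (Y ω) p₀ with h3 | h3
            · exact Or.inl ⟨h1, by linarith, h3⟩
            · exact Or.inr ⟨h1, h3⟩
          · rintro (⟨h1, h2, _⟩ | ⟨h1, h2⟩)
            · exact ⟨h1, by linarith⟩
            · exact ⟨h1, h.trans h2⟩
        have hdis : Disjoint (dn (p₀ - π d)) (B ∩ {ω | p₀ ≤ Y ω}) := by
          rw [Set.disjoint_left]
          rintro ω ⟨_, _, h2⟩ ⟨_, h3⟩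
          simp only [mem_ofPred_eq] at h3
          linarith
        have := centeredCount_union μ (hIci p₀) hdis d
        rw [← hun] at this
        rw [hSp, hS0, this, add_sub_cancel_right]
        exact hcd _ ⟨by linarith, by linarith⟩
    have hm := hmax d
    have hS0' := centeredCount_eq μ (B ∩ {ω | p₀ ≤ Y ω}) d
    have hSp' := centeredCount_eq μ (B ∩ {ω | π d ≤ Y ω}) d
    rw [← hS0] at hS0'
    rw [← hSp] at hSp'
    have hqd := mul_le_mul_of_nonneg_left (hquad (π d) (hmem d)) hn0.le
    -- The price multiplies the count, so the noise is π S(π) - p₀ S(p₀): an increment of S, plus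
    -- the price change times S(p₀).
    have hbasic : n * (c * q * (π d - p₀) ^ 2) ≤ π d * (Sp - S0) + (π d - p₀) * S0 := by
      rw [hS0', hSp']
      linarith
    have hb1 : π d * (Sp - S0) ≤ |Sp - S0| := by
      calc π d * (Sp - S0) ≤ π d * |Sp - S0| :=
            mul_le_mul_of_nonneg_left (le_abs_self _) (hmem d).1
        _ ≤ |Sp - S0| := mul_le_of_le_one_left (abs_nonneg _) (hmem d).2
    have hb2 : (π d - p₀) * S0 ≤ 2 * δ * (n * c * q * δ / 4) := by
      calc (π d - p₀) * S0 ≤ |π d - p₀| * |S0| := by rw [← abs_mul]; exact le_abs_self _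
        _ ≤ _ := mul_le_mul hd2 hc0.le (abs_nonneg _) (by positivity)
    have hx2 : δ ^ 2 ≤ (π d - p₀) ^ 2 := by
      rw [← sq_abs (π d - p₀)]; exact pow_le_pow_left₀ hδ.le hd1 2
    have := mul_le_mul_of_nonneg_left hx2 (show 0 ≤ n * (c * q) by positivity)
    nlinarith
  refine (measureReal_mono hsub).trans ((measureReal_union_le _ _).trans ?_)
  have hun := measureReal_union_le (μ := Measure.pi fun _ : Fin n => μ)
    {d | ∃ s ∈ Icc 0 (2 * δ), n * c * q * δ ^ 2 / 2 ≤ |centeredCount μ (up s) d|}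
    {d | ∃ s ∈ Icc 0 (2 * δ), n * c * q * δ ^ 2 / 2 ≤ |centeredCount μ (dn s) d|}
  have hb : ∀ a : ℝ, a ≤ M * q * (2 * δ) → 32 * n * a / (n * c * q * δ ^ 2 / 2) ^ 2
      ≤ 256 * M / c ^ 2 / (n * q * δ ^ 3) := by
    intro a ha
    refine (div_le_div_of_nonneg_right (mul_le_mul_of_nonneg_left ha (by positivity))
      (by positivity)).trans (le_of_eq ?_)
    field_simp
    ring
  have hb3 : n * μ.real (B ∩ {ω | p₀ ≤ Y ω}) / (n * c * q * δ / 4) ^ 2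
      ≤ 16 / c ^ 2 / (n * q * δ ^ 3) := by
    calc _ ≤ n * q / (n * c * q * δ / 4) ^ 2 :=
          div_le_div_of_nonneg_right (mul_le_mul_of_nonneg_left hp₀q (by positivity))
            (by positivity)
      _ = 16 / c ^ 2 / (n * q * δ ^ 2) := by field_simp; ring
      -- The term from p₀ decays only as δ^(-2); δ ≤ 1 absorbs it into δ^(-3).
      _ ≤ _ := by
          refine div_le_div_of_nonneg_left (by positivity) (by positivity) ?_
          exact mul_le_mul_of_nonneg_left (pow_le_pow_of_le_one hδ.le hδ1 (by norm_num))
            (by positivity)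
  have hfin : (512 * M + 16) / c ^ 2 / (n * q * δ ^ 3) = 256 * M / c ^ 2 / (n * q * δ ^ 3)
      + 256 * M / c ^ 2 / (n * q * δ ^ 3) + 16 / c ^ 2 / (n * q * δ ^ 3) := by
    ring
  rw [hfin]
  linarith [hb _ hupD, hb _ hdnD]

end ERM

/-! ### Revenue under a Lipschitz density -/

section LipschitzDensity

variable {g : ℝ → ℝ} {C₀ Cs : ℝ}

theorem lipschitzOnWith_of_abs_sub_le
    (hg : ∀ y ∈ Icc (0 : ℝ) 1, ∀ y' ∈ Icc (0 : ℝ) 1, |g y - g y'| ≤ C₀ * |y - y'|) :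
    LipschitzOnWith C₀.toNNReal g (Icc 0 1) := by
  refine LipschitzOnWith.of_dist_le_mul fun s hs t ht => ?_
  rw [Real.dist_eq, Real.dist_eq]
  exact (hg s hs t ht).trans (mul_le_mul_of_nonneg_right (Real.le_coe_toNNReal C₀) (abs_nonneg _))

/-- On the unit interval the density stays above g y - C₀, and it integrates to 1. -/
theorem le_of_integral_eq_one (hC₀ : 0 ≤ C₀)
    (hg : ∀ y ∈ Icc (0 : ℝ) 1, ∀ y' ∈ Icc (0 : ℝ) 1, |g y - g y'| ≤ C₀ * |y - y'|)
    (hint : IntegrableOn g (Icc 0 1)) (h1 : ∫ y in Icc (0 : ℝ) 1, g y = 1) {y : ℝ}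
    (hy : y ∈ Icc (0 : ℝ) 1) : g y ≤ 1 + C₀ := by
  have h := setIntegral_mono_on (μ := volume) (f := fun _ : ℝ => g y - C₀) (g := g)
    (integrableOn_const (by simp)) hint measurableSet_Icc (fun t ht => by
      have h2 := (abs_le.mp (hg y hy t ht)).2
      have h3 : |y - t| ≤ 1 := by
        rw [abs_le]; constructor <;> linarith [hy.1, hy.2, ht.1, ht.2]
      have := mul_le_mul_of_nonneg_left h3 hC₀
      linarith)
  rw [h1] at h
  simp at h
  linarith

theorem hasDerivAt_integral_of_continuousOn (hg : ContinuousOn g (Icc 0 1)) {y : ℝ}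
    (hy : y ∈ Ioo (0 : ℝ) 1) : HasDerivAt (fun y => ∫ t in (0 : ℝ)..y, g t) (g y) y := by
  have hnhds : Icc (0 : ℝ) 1 ∈ nhds y := Icc_mem_nhds hy.1 hy.2
  refine intervalIntegral.integral_hasDerivAt_right ?_ ?_ (hg.continuousAt hnhds)
  · refine (hg.mono ?_).intervalIntegrable
    rw [uIcc_of_le hy.1.le]
    exact Icc_subset_Icc_right hy.2.le
  · exact (hg.mono Ioo_subset_Icc_self).stronglyMeasurableAtFilter isOpen_Ioo y hy

theorem continuousOn_integral_of_continuousOn (hg : ContinuousOn g (Icc 0 1)) :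
    ContinuousOn (fun y => ∫ t in (0 : ℝ)..y, g t) (Icc 0 1) := by
  have := intervalIntegral.continuousOn_primitive_interval (μ := volume) (f := g) (a := 0) (b := 1)
    (by rw [uIcc_of_le zero_le_one]; exact hg.integrableOn_Icc)
  rwa [uIcc_of_le zero_le_one] at this

/-- Strict monotonicity, with rate `Cs`, of one minus the marginal revenue. -/
theorem mul_sub_le_cdf_add_mul_density (hg : LipschitzOnWith C₀.toNNReal g (Icc 0 1))
    (hae : ∀ᵐ y ∂((volume : Measure ℝ).restrict (Icc 0 1)), -2 * g y - y * deriv g y ≤ -Cs)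
    {a b : ℝ} (ha : 0 ≤ a) (hab : a ≤ b) (hb : b ≤ 1) :
    Cs * (b - a) ≤ ((∫ t in (0 : ℝ)..b, g t) + b * g b) - ((∫ t in (0 : ℝ)..a, g t) + a * g a) := by
  have hsub : Icc a b ⊆ Icc 0 1 := Icc_subset_Icc ha hb
  have hu : uIcc a b = Icc a b := uIcc_of_le hab
  have h01 : uIcc (0 : ℝ) 1 = Icc 0 1 := uIcc_of_le zero_le_one
  -- Absolute continuity lets the almost everywhere bound on the derivative be integrated.
  have hgac : AbsolutelyContinuousOnInterval g a b :=
    (hg.mono (by rw [hu]; exact hsub)).absolutelyContinuousOnInterval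
  have hid : AbsolutelyContinuousOnInterval (fun y : ℝ => y) a b :=
    (LipschitzWith.id.lipschitzOnWith (s := uIcc a b)).absolutelyContinuousOnInterval
  have hFac : AbsolutelyContinuousOnInterval (fun y => ∫ t in (0 : ℝ)..y, g t) a b := by
    have h := (IntervalIntegrable.absolutelyContinuousOnInterval_intervalIntegral
      (f := g) (a := 0) (b := 1) (c := 0)
      ((hg.continuousOn.mono (by rw [h01])).intervalIntegrable) (by simp))
    exact h.mono (by rw [hu, h01]; exact hsub)
  have hac : AbsolutelyContinuousOnInterval (fun y => (∫ t in (0 : ℝ)..y, g t) + y * g y) a b :=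
    hFac.add (hid.mul hgac)
  rw [← hac.integral_deriv_eq_sub, intervalIntegral.integral_of_le hab]
  have hc : Cs * (b - a) = ∫ _ in Ioc a b, Cs := by
    rw [setIntegral_const]; simp [hab]; ring
  rw [hc]
  refine setIntegral_mono_ae_restrict (integrableOn_const (by simp)) ?_ ?_
  · exact hac.intervalIntegrable_deriv.1
  · have hdiff := hg.ae_differentiableWithinAt_real measurableSet_Icc
    -- At the endpoints the Lipschitz bound does not control the two-sided `deriv`.
    have hne : ∀ᵐ y : ℝ, y ≠ 0 ∧ y ≠ 1 := by
      have h0 : ∀ᵐ y : ℝ, y ≠ 0 := by simp [ae_iff]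
      have h1 : ∀ᵐ y : ℝ, y ≠ 1 := by simp [ae_iff]
      filter_upwards [h0, h1] with y h2 h3 using ⟨h2, h3⟩
    have hsub' : Ioc a b ⊆ Icc 0 1 := Ioc_subset_Icc_self.trans hsub
    have hm := ae_mono (Measure.restrict_mono hsub' (le_refl (volume : Measure ℝ)))
    filter_upwards [hm hae, hm hdiff, ae_restrict_of_ae hne, ae_restrict_mem measurableSet_Ioc]
      with y h1 h2 h3 h4
    have hy : y ∈ Ioo (0 : ℝ) 1 :=
      ⟨lt_of_le_of_ne (hsub' h4).1 h3.1.symm, lt_of_le_of_ne (hsub' h4).2 h3.2⟩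
    have h5 : DifferentiableAt ℝ g y := h2.differentiableAt (Icc_mem_nhds hy.1 hy.2)
    have h6 := (hasDerivAt_integral_of_continuousOn hg.continuousOn hy).add
      ((hasDerivAt_id y).mul h5.hasDerivAt)
    have h7 : deriv (fun y => (∫ t in (0 : ℝ)..y, g t) + y * g y) y = _ := h6.deriv
    rw [h7]
    simp only [id]
    linarith

theorem hasDerivAt_revenue (hg : ContinuousOn g (Icc 0 1)) {y : ℝ} (hy : y ∈ Ioo (0 : ℝ) 1) :
    HasDerivAt (fun y => y * (1 - ∫ t in (0 : ℝ)..y, g t))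
      (1 - ((∫ t in (0 : ℝ)..y, g t) + y * g y)) y := by
  have h := (hasDerivAt_id y).mul ((hasDerivAt_integral_of_continuousOn hg hy).const_sub 1)
  refine h.congr_deriv ?_
  simp only [id]
  ring

theorem continuousOn_revenue (hg : ContinuousOn g (Icc 0 1)) :
    ContinuousOn (fun y => y * (1 - ∫ t in (0 : ℝ)..y, g t)) (Icc 0 1) :=
  continuousOn_id.mul (continuousOn_const.sub (continuousOn_integral_of_continuousOn hg))

theorem concaveOn_revenue_add_sq (hg : LipschitzOnWith C₀.toNNReal g (Icc 0 1))
    (hae : ∀ᵐ y ∂((volume : Measure ℝ).restrict (Icc 0 1)), -2 * g y - y * deriv g y ≤ -Cs) :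
    ConcaveOn ℝ (Icc 0 1) (fun y => y * (1 - ∫ t in (0 : ℝ)..y, g t) + Cs / 2 * y ^ 2) := by
  have hd : ∀ y ∈ Ioo (0 : ℝ) 1,
      HasDerivAt (fun y => y * (1 - ∫ t in (0 : ℝ)..y, g t) + Cs / 2 * y ^ 2)
        (1 - ((∫ t in (0 : ℝ)..y, g t) + y * g y) + Cs * y) y := by
    intro y hy
    refine ((hasDerivAt_revenue hg.continuousOn hy).add
      ((hasDerivAt_pow 2 y).const_mul (Cs / 2))).congr_deriv ?_
    norm_num
    ring
  refine AntitoneOn.concaveOn_of_deriv (convex_Icc 0 1)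
    ((continuousOn_revenue hg.continuousOn).add (by fun_prop)) ?_ ?_
  · rw [interior_Icc]
    exact fun y hy => (hd y hy).differentiableAt.differentiableWithinAt
  · rw [interior_Icc]
    intro a ha b hb hab
    rw [(hd a ha).deriv, (hd b hb).deriv]
    have := mul_sub_le_cdf_add_mul_density hg hae ha.1.le hab hb.2.le
    linarith

/-- Strong concavity without derivatives. The inequality is linear in the revenue, so it survives
averaging over the covariates of a market. The constant is Cs/2 times (b - a)²/4. -/
theorem revenue_midpoint (hg : LipschitzOnWith C₀.toNNReal g (Icc 0 1))
    (hae : ∀ᵐ y ∂((volume : Measure ℝ).restrict (Icc 0 1)), -2 * g y - y * deriv g y ≤ -Cs)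
    {a b : ℝ} (ha : a ∈ Icc (0 : ℝ) 1) (hb : b ∈ Icc (0 : ℝ) 1) :
    (a * (1 - ∫ t in (0 : ℝ)..a, g t) + b * (1 - ∫ t in (0 : ℝ)..b, g t)) / 2
        + Cs / 8 * (b - a) ^ 2
      ≤ (a + b) / 2 * (1 - ∫ t in (0 : ℝ)..((a + b) / 2), g t) := by
  have h := (concaveOn_revenue_add_sq hg hae).2 ha hb (show (0 : ℝ) ≤ 1 / 2 by norm_num)
    (show (0 : ℝ) ≤ 1 / 2 by norm_num) (by norm_num)
  simp only [smul_eq_mul] at h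
  rw [show (1 / 2 * a + 1 / 2 * b : ℝ) = (a + b) / 2 by ring] at h
  nlinarith

/-- Strict concavity is assumed at every covariate, while the rate Cs holds only at almost every
one; this version without a rate is therefore available at each covariate and on all of (0,1). -/
theorem cdf_add_mul_density_lt (hg : ContinuousOn g (Icc 0 1))
    (hsc : StrictConcaveOn ℝ (Icc 0 1) (fun y => y * (1 - ∫ t in (0 : ℝ)..y, g t)))
    {a b : ℝ} (ha : a ∈ Ioo (0 : ℝ) 1) (hb : b ∈ Ioo (0 : ℝ) 1) (hab : a < b) :
    (∫ t in (0 : ℝ)..a, g t) + a * g a < (∫ t in (0 : ℝ)..b, g t) + b * g b := by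
  have h := (hsc.subset Ioo_subset_Icc_self (convex_Ioo 0 1)).strictAntiOn_deriv
    (fun y hy => (hasDerivAt_revenue hg hy).differentiableAt) ha hb hab
  rw [(hasDerivAt_revenue hg ha).deriv, (hasDerivAt_revenue hg hb).deriv] at h
  linarith

theorem cdf_add_mul_density_eq_one (hg : ContinuousOn g (Icc 0 1)) {p : ℝ}
    (hp : p ∈ Ioo (0 : ℝ) 1)
    (hmax : IsMaxOn (fun y => y * (1 - ∫ t in (0 : ℝ)..y, g t)) (Icc 0 1) p) :
    (∫ t in (0 : ℝ)..p, g t) + p * g p = 1 := by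
  have h := (hmax.isLocalMax (Icc_mem_nhds hp.1 hp.2)).hasDerivAt_eq_zero (hasDerivAt_revenue hg hp)
  linarith

/-- A maximizer of a function satisfying a strong midpoint concavity inequality has quadratic
growth. -/
theorem quadratic_growth_of_midpoint {R : ℝ → ℝ} {κ : ℝ} {p₀ : ℝ}
    (hmid : ∀ a ∈ Icc (0 : ℝ) 1, ∀ b ∈ Icc (0 : ℝ) 1,
      (R a + R b) / 2 + κ / 8 * (b - a) ^ 2 ≤ R ((a + b) / 2))
    (hp₀ : p₀ ∈ Icc (0 : ℝ) 1) (hmax : IsMaxOn R (Icc 0 1) p₀) {p : ℝ} (hp : p ∈ Icc (0 : ℝ) 1) :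
    κ / 4 * (p - p₀) ^ 2 ≤ R p₀ - R p := by
  have h1 := hmid p₀ hp₀ p hp
  have h2 : R ((p₀ + p) / 2) ≤ R p₀ := hmax ⟨by linarith [hp.1, hp₀.1], by linarith [hp.2, hp₀.2]⟩
  linarith

end LipschitzDensity

/-! ### Lipschitz continuity of the optimal price curve -/

section OptimalPriceCurve

/-- The set where the bound fails is open and null, hence empty. This makes the almost everywhere
hypotheses pointwise near the optimal price curve. -/
theorem le_of_ae_le_of_isOpen {O : Set ℝ} (hO : IsOpen O) {k : ℝ → ℝ} (hk : ContinuousOn k O)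
    {c : ℝ} (hae : ∀ᵐ x ∂((volume : Measure ℝ).restrict O), k x ≤ c) {x : ℝ} (hx : x ∈ O) :
    k x ≤ c := by
  by_contra hcon
  have hopen : IsOpen (O ∩ k ⁻¹' Ioi c) := hk.isOpen_inter_preimage hO isOpen_Ioi
  have hnull : volume (O ∩ k ⁻¹' Ioi c) = 0 := by
    rw [ae_restrict_iff' hO.measurableSet, ae_iff] at hae
    refine measure_mono_null (fun y hy => ?_) hae
    simp only [mem_ofPred_eq, Classical.not_imp, not_le]
    exact hy
  have := (hopen.measure_eq_zero_iff volume).mp hnull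
  exact absurd (show x ∈ O ∩ k ⁻¹' Ioi c from ⟨hx, not_le.mp hcon⟩) (by rw [this]; simp)

/-- Continuous induction from a: the set of x where the bound against a holds is closed, and the
local bound extends it to the right. The radius may depend on the centre. -/
theorem abs_sub_le_of_locally {u : ℝ → ℝ} {l : ℝ}
    (hloc : ∀ x₀ ∈ Icc (0 : ℝ) 1, ∃ ε > 0, ∀ x ∈ Icc (0 : ℝ) 1, |x - x₀| < ε →
      |u x - u x₀| ≤ l * |x - x₀|) {a b : ℝ} (ha : a ∈ Icc (0 : ℝ) 1) (hb : b ∈ Icc (0 : ℝ) 1) :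
    |u b - u a| ≤ l * |b - a| := by
  wlog hab : a ≤ b generalizing a b
  · rw [abs_sub_comm, abs_sub_comm b a]
    exact this hb ha (le_of_not_ge hab)
  have hsub : Icc a b ⊆ Icc 0 1 := Icc_subset_Icc ha.1 hb.2
  have hcont : ContinuousOn u (Icc 0 1) := by
    intro x₀ hx₀
    obtain ⟨ε, hε, h⟩ := hloc x₀ hx₀
    rw [ContinuousWithinAt, tendsto_iff_dist_tendsto_zero]
    have hlim : Filter.Tendsto (fun x => l * |x - x₀|) (nhdsWithin x₀ (Icc 0 1)) (nhds 0) := by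
      have : Continuous fun x => l * |x - x₀| := by fun_prop
      have h2 := this.tendsto x₀
      simp only [sub_self, abs_zero, mul_zero] at h2
      exact h2.mono_left nhdsWithin_le_nhds
    refine squeeze_zero' (Filter.Eventually.of_forall fun _ => dist_nonneg) ?_ hlim
    filter_upwards [self_mem_nhdsWithin, nhdsWithin_le_nhds (Metric.ball_mem_nhds x₀ hε)]
      with x h1 h2
    exact h x h1 h2
  have hmain : Icc a b ⊆ {x | |u x - u a| ≤ l * (x - a)} := by
    refine IsClosed.Icc_subset_of_forall_exists_gt ?_ (by simp) ?_
    · have := isClosed_Icc.isClosed_le (s := Icc a b) (f := fun x => |u x - u a|)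
        (g := fun x => l * (x - a)) (((hcont.mono hsub).sub continuousOn_const).abs)
        (by fun_prop)
      rw [inter_comm]
      exact this
    · rintro x ⟨hx, hxab⟩ y hy
      simp only [mem_ofPred_eq] at hx
      obtain ⟨ε, hε, h⟩ := hloc x (hsub ⟨hxab.1, hxab.2.le⟩)
      obtain ⟨z, hz1, hz2⟩ := exists_between
        (show x < min (min y b) (x + ε) from lt_min (lt_min hy hxab.2) (by linarith))
      rw [lt_min_iff, lt_min_iff] at hz2
      obtain ⟨⟨hzy, hzb⟩, hzε⟩ := hz2
      refine ⟨z, ?_, hz1, hzy.le⟩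
      have h3 := h z (hsub ⟨hxab.1.trans hz1.le, hzb.le⟩)
        (by rw [abs_of_pos (by linarith)]; linarith)
      rw [abs_of_pos (a := z - x) (by linarith)] at h3
      have h4 := abs_sub_le (u z) (u x) (u a)
      simp only [mem_ofPred_eq]
      linarith
  rw [abs_of_nonneg (a := b - a) (by linarith)]
  exact hmain ⟨hab, le_rfl⟩

namespace JointDist

variable {J : JointDist} {C₀ Cs Cb U L : ℝ}

theorem InClass.lipschitzOnWith_f (h : J.InClass C₀ Cs Cb U L) {x : ℝ} (hx : x ∈ Icc (0 : ℝ) 1) :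
    LipschitzOnWith C₀.toNNReal (fun y => J.f y x) (Icc 0 1) :=
  lipschitzOnWith_of_abs_sub_le fun y hy y' hy' => h.lipschitz y hy y' hy' x hx

theorem InClass.ae_strongConcave (h : J.InClass C₀ Cs Cb U L) :
    ∀ᵐ x ∂((volume : Measure ℝ).restrict (Icc 0 1)),
      ∀ᵐ y ∂((volume : Measure ℝ).restrict (Icc 0 1)),
        -2 * J.f y x - y * deriv (fun y => J.f y x) y ≤ -Cs := by
  have h1 := h.strongConcave
  rw [unitSquare, Measure.volume_eq_prod, ← Measure.prod_restrict] at h1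
  exact Measure.ae_ae_of_ae_prod (Measure.measurePreserving_swap.quasiMeasurePreserving.ae h1)

theorem InClass.ae_bounded_x (h : J.InClass C₀ Cs Cb U L) :
    ∀ᵐ y ∂((volume : Measure ℝ).restrict (Icc 0 1)),
      ∀ᵐ x ∂((volume : Measure ℝ).restrict (Icc 0 1)),
        DifferentiableAt ℝ (fun x => J.condCDF y x) x ∧ DifferentiableAt ℝ (fun x => J.f y x) x ∧
        |deriv (fun x => J.condCDF y x) x + y * deriv (fun x => J.f y x) x| ≤ Cb := by
  have h1 := h.bounded_x
  rw [unitSquare, Measure.volume_eq_prod, ← Measure.prod_restrict] at h1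
  exact Measure.ae_ae_of_ae_prod h1

/-- Near the optimal price curve, one minus the marginal revenue is `Cb`-Lipschitz in the
covariate. -/
theorem InClass.abs_sub_le_of_box (h : J.InClass C₀ Cs Cb U L) {V : Set (ℝ × ℝ)}
    (hf : ContDiffOn ℝ 1 (fun z : ℝ × ℝ => J.f z.1 z.2) (V ∩ unitSquare))
    (hF : ContDiffOn ℝ 1 (fun z : ℝ × ℝ => J.condCDF z.1 z.2) (V ∩ unitSquare))
    {I I' : Set ℝ} (hI : IsOpen I) (hI01 : I ⊆ Icc 0 1) (hI' : I'.OrdConnected)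
    (hbox : I ×ˢ I' ⊆ V) {a b : ℝ} (ha : a ∈ I' ∩ Icc 0 1) (hb : b ∈ I' ∩ Icc 0 1)
    {y : ℝ} (hy : y ∈ I) :
    |(J.condCDF y b + y * J.f y b) - (J.condCDF y a + y * J.f y a)| ≤ Cb * |b - a| := by
  wlog hab : a < b generalizing a b
  · rcases (not_lt.mp hab).eq_or_lt with h1 | h1
    · subst h1; simp
    · rw [abs_sub_comm, abs_sub_comm b a]
      exact this hb ha h1
  have hsub : Icc a b ⊆ I' ∩ Icc 0 1 := fun x hx =>
    ⟨hI'.out ha.1 hb.1 hx, ha.2.1.trans hx.1, hx.2.trans hb.2.2⟩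
  have hcont : ∀ x ∈ Icc (0 : ℝ) 1,
      ContinuousOn (fun y => J.condCDF y x + y * J.f y x) (Icc 0 1) := fun x hx =>
    (continuousOn_integral_of_continuousOn (h.lipschitzOnWith_f hx).continuousOn).add
      (continuousOn_id.mul (h.lipschitzOnWith_f hx).continuousOn)
  have hk : ContinuousOn (fun y => |(J.condCDF y b + y * J.f y b)
      - (J.condCDF y a + y * J.f y a)|) I :=
    (((hcont b hb.2).sub (hcont a ha.2)).abs).mono hI01
  -- Both sides are continuous in the price, so almost every price t is enough. For such t the
  -- derivative bound holds at almost every covariate, hence throughout the open segment by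
  -- continuity of the derivative, and the mean value theorem applies.
  refine le_of_ae_le_of_isOpen hI hk ?_ hy
  have hm := ae_mono (Measure.restrict_mono hI01 (le_refl (volume : Measure ℝ)))
  filter_upwards [hm h.ae_bounded_x, ae_restrict_mem hI.measurableSet] with t ht htI
  have hmaps : MapsTo (fun x => (t, x)) (Icc a b) (V ∩ unitSquare) := fun x hx =>
    ⟨hbox ⟨htI, (hsub hx).1⟩, hI01 htI, (hsub hx).2⟩
  have hcd : ContDiffOn ℝ 1 (fun x => J.condCDF t x + t * J.f t x) (Icc a b) := by
    have hpair : ContDiffOn ℝ 1 (fun x : ℝ => (t, x)) (Icc a b) := by fun_prop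
    exact (hF.comp hpair hmaps).add (contDiffOn_const.mul (hf.comp hpair hmaps))
  have hdiff : DifferentiableOn ℝ (fun x => J.condCDF t x + t * J.f t x) (Ioo a b) :=
    (hcd.mono Ioo_subset_Icc_self).differentiableOn one_ne_zero
  have hderiv : ContinuousOn (fun x => |deriv (fun x => J.condCDF t x + t * J.f t x) x|)
      (Ioo a b) :=
    ((hcd.mono Ioo_subset_Icc_self).continuousOn_deriv_of_isOpen isOpen_Ioo le_rfl).abs
  obtain ⟨c, hc, hc'⟩ := exists_deriv_eq_slope (fun x => J.condCDF t x + t * J.f t x) hab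
    hcd.continuousOn hdiff
  have hle : |deriv (fun x => J.condCDF t x + t * J.f t x) c| ≤ Cb := by
    refine le_of_ae_le_of_isOpen isOpen_Ioo hderiv ?_ hc
    have hm' := ae_mono (Measure.restrict_mono (Ioo_subset_Icc_self.trans
      (hsub.trans inter_subset_right)) (le_refl (volume : Measure ℝ)))
    filter_upwards [hm' ht] with x hx
    have := (hx.1.hasDerivAt.add (hx.2.1.hasDerivAt.const_mul t)).deriv
    have h7 : deriv (fun x => J.condCDF t x + t * J.f t x) x = _ := this
    rw [h7]
    exact hx.2.2
  rw [hc', abs_div, div_le_iff₀ (abs_pos.mpr (by linarith))] at hle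
  exact hle

/-- The rate Cs is known for almost every covariate only. A covariate x within ε of x₀ where it
holds is compared with x₀ at both prices, at a total cost of at most 2 |Cb| ε, and ε is arbitrary.
-/
theorem InClass.mul_sub_le_of_box (h : J.InClass C₀ Cs Cb U L) {V : Set (ℝ × ℝ)}
    (hf : ContDiffOn ℝ 1 (fun z : ℝ × ℝ => J.f z.1 z.2) (V ∩ unitSquare))
    (hF : ContDiffOn ℝ 1 (fun z : ℝ × ℝ => J.condCDF z.1 z.2) (V ∩ unitSquare))
    {I : Set ℝ} (hI : IsOpen I) (hI01 : I ⊆ Icc 0 1) {x₀ r : ℝ} (hr : 0 < r)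
    (hx₀ : x₀ ∈ Icc (0 : ℝ) 1) (hbox : I ×ˢ Ioo (x₀ - r) (x₀ + r) ⊆ V)
    {y y' : ℝ} (hy : y ∈ I) (hy' : y' ∈ I) (hyy' : y ≤ y') :
    Cs * (y' - y) ≤ (J.condCDF y' x₀ + y' * J.f y' x₀) - (J.condCDF y x₀ + y * J.f y x₀) := by
  refine le_of_forall_pos_le_add fun η hη => ?_
  obtain ⟨ε, hε0, hεr, hε⟩ : ∃ ε, 0 < ε ∧ ε ≤ r ∧ 2 * (|Cb| * ε) ≤ η := by
    refine ⟨min r (η / (2 * (|Cb| + 1))), lt_min hr (by positivity), min_le_left _ _, ?_⟩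
    calc 2 * (|Cb| * min r (η / (2 * (|Cb| + 1))))
        ≤ 2 * ((|Cb| + 1) * (η / (2 * (|Cb| + 1)))) := by
          gcongr
          · linarith
          · exact min_le_right _ _
      _ = η := by field_simp
  obtain ⟨x, ⟨hxr, hx01⟩, hx⟩ : ∃ x, (x ∈ Ioo (x₀ - ε) (x₀ + ε) ∧ x ∈ Icc (0 : ℝ) 1) ∧
      ∀ᵐ y ∂((volume : Measure ℝ).restrict (Icc 0 1)),
        -2 * J.f y x - y * deriv (fun y => J.f y x) y ≤ -Cs := by
    -- Clipped to the unit interval because x₀ may be an endpoint; it still has positive length.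
    set O := Ioo (max 0 (x₀ - ε)) (min 1 (x₀ + ε)) with hO
    have hne : (volume : Measure ℝ) O ≠ 0 := by
      rw [hO, Real.volume_Ioo]
      simp only [ne_eq, ENNReal.ofReal_eq_zero, not_le, sub_pos]
      rw [lt_min_iff, max_lt_iff, max_lt_iff]
      refine ⟨⟨?_, ?_⟩, ?_, ?_⟩ <;> linarith [hx₀.1, hx₀.2]
    have hO01 : O ⊆ Icc 0 1 := fun x hx =>
      ⟨(le_max_left _ _).trans hx.1.le, hx.2.le.trans (min_le_left _ _)⟩
    have hm := ae_mono (Measure.restrict_mono hO01 (le_refl (volume : Measure ℝ)))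
    have hgood := Filter.Eventually.and (hm h.ae_strongConcave)
      (ae_restrict_mem (μ := volume) (measurableSet_Ioo : MeasurableSet O))
    have : (ae (volume.restrict O)).NeBot := by
      rw [ae_neBot, Ne, Measure.restrict_eq_zero]; exact hne
    obtain ⟨x, hx1, hx2⟩ := hgood.exists
    exact ⟨x, ⟨⟨(le_max_right _ _).trans_lt hx2.1, hx2.2.trans_le (min_le_right _ _)⟩,
      hO01 hx2⟩, hx1⟩
  have hxx : |x - x₀| ≤ ε := by rw [abs_le]; constructor <;> linarith [hxr.1, hxr.2]
  have h1 := mul_sub_le_cdf_add_mul_density (h.lipschitzOnWith_f hx01) hx (hI01 hy).1 hyy'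
    (hI01 hy').2
  have hxI : x ∈ Ioo (x₀ - r) (x₀ + r) ∩ Icc 0 1 :=
    ⟨⟨by linarith [hxr.1], by linarith [hxr.2]⟩, hx01⟩
  have hx₀I : x₀ ∈ Ioo (x₀ - r) (x₀ + r) ∩ Icc 0 1 := ⟨⟨by linarith, by linarith⟩, hx₀⟩
  have h2 := (abs_le.mp (h.abs_sub_le_of_box hf hF hI hI01 ordConnected_Ioo hbox hx₀I hxI hy))
  have h3 := (abs_le.mp (h.abs_sub_le_of_box hf hF hI hI01 ordConnected_Ioo hbox hx₀I hxI hy'))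
  have h4 : Cb * |x - x₀| ≤ |Cb| * ε :=
    mul_le_mul (le_abs_self _) hxx (abs_nonneg _) (abs_nonneg _)
  simp only [JointDist.condCDF] at h2 h3 ⊢
  linarith [h2.1, h3.2]

/-- The optimal price is a Lipschitz function of the covariate. -/
theorem InClass.exists_optimalPrice (h : J.InClass C₀ Cs Cb U L) (hCs : 0 < Cs) (hCb : 0 < Cb) :
    ∃ p : ℝ → ℝ, (∀ x ∈ Icc (0 : ℝ) 1,
      p x ∈ Ioo (0 : ℝ) 1 ∧ IsMaxOn (fun y => J.rev y x) (Icc 0 1) (p x)) ∧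
      ∀ x ∈ Icc (0 : ℝ) 1, ∀ x' ∈ Icc (0 : ℝ) 1, |p x' - p x| ≤ Cb / Cs * |x' - x| := by
  obtain ⟨p, hp, V, hV, hpV, hf, hF⟩ := h.interior_smooth
  refine ⟨p, hp, fun x hx x' hx' => abs_sub_le_of_locally ?_ hx hx'⟩
  intro x₀ hx₀
  obtain ⟨ρ, hρ, hball⟩ := Metric.isOpen_iff.mp hV _ (hpV x₀ hx₀)
  have hp₀ := (hp x₀ hx₀).1
  set r := min ρ (min (p x₀) (1 - p x₀)) with hr
  have hr0 : 0 < r := lt_min hρ (lt_min hp₀.1 (by linarith [hp₀.2]))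
  have hr1 : r ≤ p x₀ := (min_le_right _ _).trans (min_le_left _ _)
  have hr2 : r ≤ 1 - p x₀ := (min_le_right _ _).trans (min_le_right _ _)
  set I := Ioo (p x₀ - r) (p x₀ + r) with hI
  have hI01 : I ⊆ Ioo 0 1 := Ioo_subset_Ioo (by linarith) (by linarith)
  have hI01' : I ⊆ Icc 0 1 := hI01.trans Ioo_subset_Icc_self
  have hbox : I ×ˢ Ioo (x₀ - r) (x₀ + r) ⊆ V := by
    rintro ⟨y, x⟩ ⟨hy, hx⟩
    apply hball
    rw [Metric.mem_ball, Prod.dist_eq, max_lt_iff, Real.dist_eq, Real.dist_eq, abs_lt, abs_lt]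
    have : r ≤ ρ := min_le_left _ _
    simp only [hI, mem_Ioo] at hy hx
    refine ⟨⟨?_, ?_⟩, ?_, ?_⟩ <;> simp only <;> linarith [hy.1, hy.2, hx.1, hx.2]
  -- The second bound gives D = (Cb/Cs)|x - x₀| < r, so that p x₀ ± D stay in the box.
  refine ⟨min r (r * Cs / Cb), lt_min hr0 (by positivity), fun x hx hxx => ?_⟩
  have hxr : |x - x₀| < r := hxx.trans_le (min_le_left _ _)
  have hD : Cb / Cs * |x - x₀| < r := by
    have := hxx.trans_le (min_le_right _ _)
    rw [lt_div_iff₀ hCb] at this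
    rw [div_mul_eq_mul_div, div_lt_iff₀ hCs]
    linarith
  set D := Cb / Cs * |x - x₀| with hDdef
  have hD0 : 0 ≤ D := by positivity
  have hCsD : Cs * D = Cb * |x - x₀| := by rw [hDdef]; field_simp
  have hxI : x ∈ Ioo (x₀ - r) (x₀ + r) ∩ Icc 0 1 := by
    have := abs_lt.mp hxr
    exact ⟨⟨by linarith, by linarith⟩, hx⟩
  have hx₀I : x₀ ∈ Ioo (x₀ - r) (x₀ + r) ∩ Icc 0 1 := ⟨⟨by linarith, by linarith⟩, hx₀⟩
  have hup : p x₀ + D ∈ I := ⟨by linarith, by linarith⟩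
  have hdn : p x₀ - D ∈ I := ⟨by linarith, by linarith⟩
  have hmid : p x₀ ∈ I := ⟨by linarith, by linarith⟩
  have hFOC : ∀ x ∈ Icc (0 : ℝ) 1, J.condCDF (p x) x + p x * J.f (p x) x = 1 := fun x hx =>
    cdf_add_mul_density_eq_one (h.lipschitzOnWith_f hx).continuousOn (hp x hx).1 (hp x hx).2
  have hmono : ∀ a ∈ Ioo (0 : ℝ) 1, ∀ b ∈ Ioo (0 : ℝ) 1, a < b →
      J.condCDF a x + a * J.f a x < J.condCDF b x + b * J.f b x := fun a ha b hb hab =>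
    cdf_add_mul_density_lt (h.lipschitzOnWith_f hx).continuousOn (h.strictConcave x hx) ha hb hab
  rw [abs_le]
  constructor
  -- Let h(y, x) = F + y f, which equals 1 on the curve. Then h(p x₀ - D, x) ≤ h(p x₀ - D, x₀) +
  -- Cb|x - x₀| ≤ 1 - Cs D + Cb|x - x₀| = 1, while p x < p x₀ - D would make it exceed 1. Only
  -- strict monotonicity is used at p x, which need not lie in the box.
  · by_contra hcon
    have h1 := hmono (p x) (hp x hx).1 (p x₀ - D) (hI01 hdn) (by linarith)
    have h2 := (h.abs_sub_le_of_box hf hF isOpen_Ioo hI01' ordConnected_Ioo hbox hx₀I hxI hdn)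
    have h3 := h.mul_sub_le_of_box hf hF isOpen_Ioo hI01' hr0 hx₀ hbox hdn hmid (by linarith)
    rw [hFOC x hx] at h1
    rw [hFOC x₀ hx₀] at h3
    linarith [(abs_le.mp h2).2]
  · by_contra hcon
    have h1 := hmono (p x₀ + D) (hI01 hup) (p x) (hp x hx).1 (by linarith)
    have h2 := (h.abs_sub_le_of_box hf hF isOpen_Ioo hI01' ordConnected_Ioo hbox hx₀I hxI hup)
    have h3 := h.mul_sub_le_of_box hf hF isOpen_Ioo hI01' hr0 hx₀ hbox hmid hup (by linarith)
    rw [hFOC x hx] at h1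
    rw [hFOC x₀ hx₀] at h3
    linarith [(abs_le.mp h2).1]

end JointDist

end OptimalPriceCurve

/-! ### Welfare differences, the joint law and uniqueness of the optimal strategy -/

/-- The integrands differ only when Y lies between the two prices, and then by at most Y ≤ 1. -/
theorem abs_welfare_sub_le {Ω : Type*} [MeasurableSpace Ω] (μ : Measure Ω) [IsFiniteMeasure μ]
    {Y s t : Ω → ℝ} (hY : Measurable Y) (hs : Measurable s) (ht : Measurable t)
    (hY01 : ∀ᵐ ω ∂μ, Y ω ∈ Icc (0 : ℝ) 1) :
    |∫ ω, {ω | s ω < Y ω}.indicator Y ω ∂μ - ∫ ω, {ω | t ω < Y ω}.indicator Y ω ∂μ|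
      ≤ μ.real {ω | Y ω ∈ uIcc (s ω) (t ω)} := by
  have hYi : Integrable Y μ := by
    refine Integrable.of_bound hY.aestronglyMeasurable 1 ?_
    filter_upwards [hY01] with ω h
    rw [Real.norm_eq_abs, abs_of_nonneg h.1]; exact h.2
  have hE : MeasurableSet {ω | Y ω ∈ uIcc (s ω) (t ω)} := by
    simp only [uIcc, mem_Icc]
    exact (measurableSet_le (hs.min ht) hY).inter (measurableSet_le hY (hs.max ht))
  rw [← integral_sub (hYi.indicator (measurableSet_lt hs hY))
    (hYi.indicator (measurableSet_lt ht hY))]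
  rw [← integral_indicator_one hE]
  refine (abs_integral_le_integral_abs).trans (integral_mono_ae ?_ ?_ ?_)
  · exact ((hYi.indicator (measurableSet_lt hs hY)).sub
      (hYi.indicator (measurableSet_lt ht hY))).abs
  · exact (integrable_const (1 : ℝ)).indicator hE
  · filter_upwards [hY01] with ω h
    by_cases h1 : s ω < Y ω <;> by_cases h2 : t ω < Y ω
    · simp only [indicator, mem_ofPred_eq, h1, h2, if_true, sub_self, abs_zero]
      split_ifs <;> simp
    · have : Y ω ∈ uIcc (s ω) (t ω) := mem_uIcc.mpr (Or.inl ⟨h1.le, not_lt.mp h2⟩)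
      simp [indicator, h1, h2, this, abs_of_nonneg h.1, h.2]
    · have : Y ω ∈ uIcc (s ω) (t ω) := mem_uIcc.mpr (Or.inr ⟨h2.le, not_lt.mp h1⟩)
      simp [indicator, h1, h2, this, abs_of_nonneg h.1, h.2]
    · simp only [indicator, mem_ofPred_eq, h1, h2, if_false, sub_self, abs_zero]
      split_ifs <;> simp

namespace JointDist

variable {J : JointDist} {C₀ Cs Cb U L : ℝ}

theorem measurableSet_unitSquare : MeasurableSet unitSquare :=
  measurableSet_Icc.prod measurableSet_Icc

theorem InClass.f_le (h : J.InClass C₀ Cs Cb U L) (hC₀ : 0 ≤ C₀) {y x : ℝ}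
    (hy : y ∈ Icc (0 : ℝ) 1) (hx : x ∈ Icc (0 : ℝ) 1) : J.f y x ≤ 1 + C₀ :=
  le_of_integral_eq_one hC₀ (fun y hy y' hy' => h.lipschitz y hy y' hy' x hx)
    (J.integrable_f x hx) (J.integral_f x hx) hy

theorem InClass.density_le (h : J.InClass C₀ Cs Cb U L) (hC₀ : 0 ≤ C₀) {z : ℝ × ℝ}
    (hz : z ∈ unitSquare) : J.f z.1 z.2 * J.fX z.2 ≤ (1 + C₀) * U :=
  mul_le_mul (h.f_le hC₀ hz.1 hz.2) (h.marginal z.2 hz.2).2 (J.fX_nonneg z.2 hz.2) (by linarith)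

theorem density_nonneg {z : ℝ × ℝ} (hz : z ∈ unitSquare) : 0 ≤ J.f z.1 z.2 * J.fX z.2 :=
  mul_nonneg (J.f_nonneg _ hz.1 _ hz.2) (J.fX_nonneg _ hz.2)

theorem measurable_density : Measurable fun z : ℝ × ℝ => J.f z.1 z.2 * J.fX z.2 :=
  J.measurable_f.mul (J.measurable_fX.comp measurable_snd)

theorem InClass.integrableOn_density (h : J.InClass C₀ Cs Cb U L) (hC₀ : 0 ≤ C₀) :
    IntegrableOn (fun z : ℝ × ℝ => J.f z.1 z.2 * J.fX z.2) unitSquare := by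
  refine Measure.integrableOn_of_bounded (M := (1 + C₀) * U) ?_
    measurable_density.aestronglyMeasurable ?_
  · rw [unitSquare, Measure.volume_eq_prod, Measure.prod_prod]; simp
  · filter_upwards [ae_restrict_mem measurableSet_unitSquare] with z hz
    rw [Real.norm_eq_abs, abs_of_nonneg (density_nonneg hz)]
    exact h.density_le hC₀ hz

theorem InClass.law_real_eq (h : J.InClass C₀ Cs Cb U L) (hC₀ : 0 ≤ C₀) {A S : Set ℝ}
    (hA : MeasurableSet A) (hS : MeasurableSet S) :
    J.law.real {z | z.2 ∈ S ∧ z.1 ∈ A}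
      = ∫ x in S ∩ Icc 0 1, J.fX x * ∫ y in A ∩ Icc 0 1, J.f y x := by
  have hprod : MeasurableSet (A ×ˢ S) := hA.prod hS
  have hset : {z : ℝ × ℝ | z.2 ∈ S ∧ z.1 ∈ A} = A ×ˢ S := by
    ext z; simp only [mem_ofPred_eq, mem_prod]; tauto
  have hinter : A ×ˢ S ∩ unitSquare = (A ∩ Icc 0 1) ×ˢ (S ∩ Icc 0 1) := by
    rw [unitSquare, prod_inter_prod]
  have hint := (h.integrableOn_density hC₀).mono_set
    (show A ×ˢ S ∩ unitSquare ⊆ unitSquare from inter_subset_right)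
  rw [hset, Measure.real, law, withDensity_apply _ hprod, Measure.restrict_restrict hprod,
    ← ofReal_integral_eq_lintegral_ofReal hint, ENNReal.toReal_ofReal]
  · rw [hinter] at hint ⊢
    rw [Measure.volume_eq_prod] at hint ⊢
    have hint' : IntegrableOn (fun z : ℝ × ℝ => J.f z.2 z.1 * J.fX z.1)
        ((S ∩ Icc 0 1) ×ˢ (A ∩ Icc 0 1)) (volume.prod volume) := hint.swap
    rw [← setIntegral_prod_swap]
    simp only [Prod.fst_swap, Prod.snd_swap]
    rw [setIntegral_prod _ hint']
    refine integral_congr_ae (Filter.Eventually.of_forall fun x => ?_)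
    simp only
    rw [integral_mul_const, mul_comm]
  · exact setIntegral_nonneg (hprod.inter measurableSet_unitSquare)
      fun z hz => density_nonneg hz.2
  · filter_upwards [ae_restrict_mem (hprod.inter measurableSet_unitSquare)] with z hz
      using density_nonneg hz.2

theorem InClass.isProbabilityMeasure_law (h : J.InClass C₀ Cs Cb U L) (hC₀ : 0 ≤ C₀) :
    IsProbabilityMeasure J.law := by
  have h1 := h.law_real_eq hC₀ (MeasurableSet.univ) (MeasurableSet.univ)
  simp only [mem_univ, and_self, univ_inter] at h1
  have h2 : ∫ x in Icc (0 : ℝ) 1, J.fX x * ∫ y in Icc (0 : ℝ) 1, J.f y x = 1 := by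
    refine Eq.trans ?_ J.integral_fX
    refine integral_congr_ae ?_
    filter_upwards [ae_restrict_mem measurableSet_Icc] with x hx
    rw [J.integral_f x hx, mul_one]
  rw [h2] at h1
  refine ⟨?_⟩
  rw [Measure.real, ENNReal.toReal_eq_one_iff] at h1
  exact h1

theorem ae_law_mem_unitSquare : ∀ᵐ z ∂J.law, z ∈ unitSquare := by
  rw [law]
  exact (withDensity_absolutelyContinuous _ _).ae_le (ae_restrict_mem measurableSet_unitSquare)

theorem InClass.law_le (h : J.InClass C₀ Cs Cb U L) (hC₀ : 0 ≤ C₀) {E : Set (ℝ × ℝ)}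
    (hE : MeasurableSet E) : J.law E ≤ ENNReal.ofReal ((1 + C₀) * U) * volume (E ∩ unitSquare) := by
  rw [law, withDensity_apply _ hE, Measure.restrict_restrict hE]
  calc _ ≤ ∫⁻ _ in E ∩ unitSquare, ENNReal.ofReal ((1 + C₀) * U) :=
        setLIntegral_mono measurable_const fun z hz =>
          ENNReal.ofReal_le_ofReal (h.density_le hC₀ hz.2)
    _ = _ := by rw [setLIntegral_const]

/-- The region between the two price curves has area at most the L¹ distance, and the density is at
most (1 + C₀) U. -/
theorem InClass.abs_welfare_sub_le (h : J.InClass C₀ Cs Cb U L) (hC₀ : 0 ≤ C₀) (hU : 0 ≤ U)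
    {p p' : ℝ → ℝ} (hp : Measurable p) (hp' : Measurable p')
    (hint : IntegrableOn (fun x => |p x - p' x|) (Icc 0 1)) :
    |welfare J.law p - welfare J.law p'| ≤ (1 + C₀) * U * ∫ x in Icc (0 : ℝ) 1, |p x - p' x| := by
  have := h.isProbabilityMeasure_law hC₀
  have hps : Measurable fun z : ℝ × ℝ => p z.2 := hp.comp measurable_snd
  have hps' : Measurable fun z : ℝ × ℝ => p' z.2 := hp'.comp measurable_snd
  refine (Pricing.abs_welfare_sub_le J.law (Y := Prod.fst) (s := fun z => p z.2)
    (t := fun z => p' z.2) measurable_fst hps hps'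
    (by filter_upwards [ae_law_mem_unitSquare] with z hz using hz.1)).trans ?_
  set E : Set (ℝ × ℝ) := {z | z.1 ∈ uIcc (p z.2) (p' z.2)} with hEdef
  have hE : MeasurableSet E := by
    simp only [hEdef, uIcc, mem_Icc]
    exact (measurableSet_le (hps.min hps') measurable_fst).inter
      (measurableSet_le measurable_fst (hps.max hps'))
  have hvol : volume (E ∩ unitSquare)
      ≤ ENNReal.ofReal (∫ x in Icc (0 : ℝ) 1, |p x - p' x|) := by
    rw [ofReal_integral_eq_lintegral_ofReal hint (ae_of_all _ fun x => abs_nonneg _),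
      Measure.volume_eq_prod, Measure.prod_apply_symm (hE.inter measurableSet_unitSquare),
      ← lintegral_indicator measurableSet_Icc]
    refine lintegral_mono fun x => ?_
    by_cases hx : x ∈ Icc (0 : ℝ) 1
    · rw [indicator_of_mem hx]
      refine (measure_mono (t := uIcc (p x) (p' x)) fun y hy => hy.1).trans (le_of_eq ?_)
      rw [Real.volume_interval, abs_sub_comm]
    · rw [indicator_of_notMem hx]
      have : (fun y => (y, x)) ⁻¹' (E ∩ unitSquare) = ∅ := by
        ext y
        simp only [mem_preimage, mem_inter_iff, mem_empty_iff_false, iff_false]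
        exact fun hy => hx hy.2.2
      rw [this, measure_empty]
  have hM : 0 ≤ (1 + C₀) * U := by positivity
  have hI : 0 ≤ ∫ x in Icc (0 : ℝ) 1, |p x - p' x| := integral_nonneg fun x => abs_nonneg _
  refine ENNReal.toReal_le_of_le_ofReal (by positivity) ?_
  rw [ENNReal.ofReal_mul hM]
  exact (h.law_le hC₀ hE).trans (mul_le_mul_right hvol _)

theorem condCDF_nonneg {y x : ℝ} (hy : y ∈ Icc (0 : ℝ) 1) (hx : x ∈ Icc (0 : ℝ) 1) :
    0 ≤ J.condCDF y x :=
  intervalIntegral.integral_nonneg hy.1 fun t ht => J.f_nonneg t ⟨ht.1, ht.2.trans hy.2⟩ x hx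

theorem setIntegral_f_eq {y x : ℝ} (hy : y ∈ Icc (0 : ℝ) 1) (hx : x ∈ Icc (0 : ℝ) 1) :
    ∫ t in Icc y 1, J.f t x = 1 - J.condCDF y x := by
  have hint : ∀ a ∈ Icc (0 : ℝ) 1, ∀ b ∈ Icc (0 : ℝ) 1,
      IntervalIntegrable (fun t => J.f t x) volume a b := fun a ha b hb =>
    ((J.integrable_f x hx).mono_set (uIcc_subset_Icc ha hb)).intervalIntegrable
  have h01 : ∫ t in (0 : ℝ)..1, J.f t x = 1 := by
    rw [intervalIntegral.integral_of_le zero_le_one, ← integral_Icc_eq_integral_Ioc,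
      J.integral_f x hx]
  have h2 := intervalIntegral.integral_add_adjacent_intervals (hint 0 (by simp) y hy)
    (hint y hy 1 (by simp))
  rw [integral_Icc_eq_integral_Ioc, ← intervalIntegral.integral_of_le hy.2, condCDF]
  linarith

theorem condCDF_le_one {y x : ℝ} (hy : y ∈ Icc (0 : ℝ) 1) (hx : x ∈ Icc (0 : ℝ) 1) :
    J.condCDF y x ≤ 1 := by
  have h : 0 ≤ ∫ t in Icc y 1, J.f t x :=
    setIntegral_nonneg measurableSet_Icc fun t ht => J.f_nonneg t ⟨hy.1.trans ht.1, ht.2⟩ x hx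
  rw [setIntegral_f_eq hy hx] at h
  linarith

/-- The distribution function at the moving point p x is the integral in t of a jointly measurable
function, the density cut off to 0 < t ≤ p x. -/
theorem aestronglyMeasurable_rev {p : ℝ → ℝ} (hp : IsPricing p) :
    AEStronglyMeasurable (fun x => J.rev (p x) x) (volume.restrict (Icc 0 1)) := by
  set E : Set (ℝ × ℝ) := {z | 0 < z.1 ∧ z.1 ≤ p z.2} with hEdef
  have hE : MeasurableSet E :=
    (measurableSet_lt measurable_const measurable_fst).inter
      (measurableSet_le measurable_fst (hp.1.comp measurable_snd))
  have hm : StronglyMeasurable fun x => ∫ t, E.indicator (Function.uncurry J.f) (t, x) :=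
    (J.measurable_f.indicator hE).stronglyMeasurable.integral_prod_left'
  have hm' : AEStronglyMeasurable
      (fun x => p x * (1 - ∫ t, E.indicator (Function.uncurry J.f) (t, x)))
      (volume.restrict (Icc 0 1)) :=
    (hp.1.mul (measurable_const.sub hm.measurable)).aestronglyMeasurable
  refine hm'.congr ?_
  filter_upwards [ae_restrict_mem measurableSet_Icc] with x hx
  rw [rev, condCDF, intervalIntegral.integral_of_le (hp.2 x hx).1,
    ← integral_indicator measurableSet_Ioc]
  rfl

theorem abs_rev_le {y x : ℝ} (hy : y ∈ Icc (0 : ℝ) 1) (hx : x ∈ Icc (0 : ℝ) 1) :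
    |J.rev y x| ≤ 1 := by
  have h1 := condCDF_nonneg (J := J) hy hx
  have h2 := condCDF_le_one (J := J) hy hx
  rw [rev, abs_of_nonneg (mul_nonneg hy.1 (by linarith))]
  exact mul_le_one₀ hy.2 (by linarith) (by linarith)

theorem integrableOn_rev_mul {p : ℝ → ℝ} (hp : IsPricing p) :
    IntegrableOn (fun x => J.rev (p x) x * J.fX x) (Icc 0 1) := by
  refine J.integrable_fX.bdd_mul (c := 1) (aestronglyMeasurable_rev hp) ?_
  filter_upwards [ae_restrict_mem measurableSet_Icc] with x hx
  exact abs_rev_le (hp.2 x hx) hx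

/-- The pointwise revenue loss is nonnegative and its integral is not positive, so it vanishes
almost everywhere. Since f_X ≥ L > 0 the revenues agree, and strict concavity makes the maximizer
unique. -/
theorem InClass.isOptimal_ae_eq (h : J.InClass C₀ Cs Cb U L) (hL : 0 < L) {p pD : ℝ → ℝ}
    (hp : IsPricing p)
    (hmax : ∀ x ∈ Icc (0 : ℝ) 1, IsMaxOn (fun y => J.rev y x) (Icc 0 1) (p x))
    (hpD : J.IsOptimal pD) : ∀ᵐ x ∂((volume : Measure ℝ).restrict (Icc 0 1)), pD x = p x := by
  have hle := hpD.2 p hp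
  have hi := integrableOn_rev_mul (J := J) hp
  have hiD := integrableOn_rev_mul (J := J) hpD.1
  have hnn : 0 ≤ᵐ[volume.restrict (Icc (0 : ℝ) 1)]
      fun x => J.rev (p x) x * J.fX x - J.rev (pD x) x * J.fX x := by
    filter_upwards [ae_restrict_mem measurableSet_Icc] with x hx
    rw [← sub_mul]
    exact mul_nonneg (sub_nonneg.mpr (hmax x hx (hpD.1.2 x hx))) (J.fX_nonneg x hx)
  have hz : ∫ x in Icc (0 : ℝ) 1, (J.rev (p x) x * J.fX x - J.rev (pD x) x * J.fX x) = 0 := by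
    refine le_antisymm ?_ (integral_nonneg_of_ae hnn)
    rw [integral_sub hi hiD]
    simp only [expRev] at hle
    linarith
  rw [integral_eq_zero_iff_of_nonneg_ae hnn (hi.sub hiD)] at hz
  filter_upwards [hz, ae_restrict_mem measurableSet_Icc] with x hx hx01
  have hfX : 0 < J.fX x := hL.trans_le (h.marginal x hx01).1
  have heq : J.rev (p x) x = J.rev (pD x) x := by
    rw [Pi.zero_apply, ← sub_mul] at hx
    have := (mul_eq_zero.mp hx).resolve_right hfX.ne'
    linarith
  refine (h.strictConcave x hx01).eq_of_isMaxOn (fun y hy => ?_) (hmax x hx01)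
    (hpD.1.2 x hx01) (hp.2 x hx01)
  have := hmax x hx01 hy
  simp only [mem_ofPred_eq] at this ⊢
  linarith

end JointDist

/-! ### Markets and piecewise constant prices -/

theorem le_of_concaveOn_of_isMaxOn {s : Set ℝ} {u : ℝ → ℝ} (hu : ConcaveOn ℝ s u) {a b m : ℝ}
    (ha : a ∈ s) (hm : m ∈ s) (hb : b ∈ Icc a m) (hmax : IsMaxOn u s m) : u a ≤ u b := by
  have h := hu.min_le_of_mem_Icc ha hm hb
  rwa [min_eq_left (hmax ha)] at h

theorem market_subset {K : ℕ} (k : Fin K) : market K k ⊆ Icc 0 1 := by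
  have hK : (0 : ℝ) < K := by exact_mod_cast k.pos
  have hk : ((k : ℕ) : ℝ) + 1 ≤ K := by exact_mod_cast k.isLt
  intro x hx
  refine ⟨le_trans (by positivity) hx.1, hx.2.le.trans ?_⟩
  rw [div_le_one hK]
  exact hk

theorem measurableSet_market {K : ℕ} (k : Fin K) : MeasurableSet (market K k) := measurableSet_Ico

theorem volume_real_market {K : ℕ} (k : Fin K) :
    (volume : Measure ℝ).real (market K k) = 1 / K := by
  have hK : (0 : ℝ) < K := by exact_mod_cast k.pos
  rw [market, Real.volume_real_Ico_of_le (by gcongr; linarith)]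
  ring

theorem abs_sub_le_of_mem_market {K : ℕ} {k : Fin K} {x x' : ℝ} (hx : x ∈ market K k)
    (hx' : x' ∈ market K k) : |x - x'| ≤ 1 / K := by
  have h : ((k : ℝ) + 1) / K = k / K + 1 / K := by ring
  have h1 := hx.2
  have h2 := hx'.2
  rw [h] at h1 h2
  rw [abs_le]
  constructor <;> linarith [hx.1, hx'.1]

theorem left_mem_market {K : ℕ} (k : Fin K) : ((k : ℕ) : ℝ) / K ∈ market K k := by
  have hK : (0 : ℝ) < K := by exact_mod_cast k.pos
  exact ⟨le_rfl, by gcongr; linarith⟩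

theorem market_eq_of_mem {K : ℕ} {k k' : Fin K} {x : ℝ} (hx : x ∈ market K k)
    (hx' : x ∈ market K k') : k = k' := by
  have hK : (0 : ℝ) < K := by exact_mod_cast k.pos
  have h1 : ((k : ℕ) : ℝ) < (k' : ℕ) + 1 :=
    (div_lt_div_iff_of_pos_right hK).mp (hx.1.trans_lt hx'.2)
  have h2 : ((k' : ℕ) : ℝ) < (k : ℕ) + 1 :=
    (div_lt_div_iff_of_pos_right hK).mp (hx'.1.trans_lt hx.2)
  have h3 : (k : ℕ) < k' + 1 := by exact_mod_cast h1
  have h4 : (k' : ℕ) < k + 1 := by exact_mod_cast h2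
  exact Fin.ext (by omega)

theorem exists_mem_market {K : ℕ} (hK : 0 < K) {x : ℝ} (hx : x ∈ Ico (0 : ℝ) 1) :
    ∃ k : Fin K, x ∈ market K k := by
  have hK' : (0 : ℝ) < K := by exact_mod_cast hK
  have h0 : 0 ≤ x * K := mul_nonneg hx.1 hK'.le
  refine ⟨⟨⌊x * K⌋₊, ?_⟩, ?_, ?_⟩
  · rw [Nat.floor_lt h0]
    nlinarith [hx.2]
  · rw [div_le_iff₀ hK']
    exact Nat.floor_le h0
  · rw [lt_div_iff₀ hK']
    exact Nat.lt_floor_add_one _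

theorem piecewisePrice_eq {K : ℕ} (q : Fin K → ℝ) {k : Fin K} {x : ℝ} (hx : x ∈ market K k) :
    piecewisePrice q x = q k := by
  rw [piecewisePrice, Finset.sum_eq_single k]
  · exact indicator_of_mem hx _
  · intro k' _ hk'
    exact indicator_of_notMem (fun h => hk' (market_eq_of_mem h hx)) _
  · simp

theorem measurable_piecewisePrice {K : ℕ} (q : Fin K → ℝ) : Measurable (piecewisePrice q) :=
  Finset.measurable_sum _ fun k _ => measurable_const.indicator (measurableSet_market k)

/-- Bound for the distance of a piecewise constant price to a price that varies little within each
market. -/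
theorem integral_abs_piecewisePrice_sub_le {K : ℕ} (hK : 0 < K) (q r : Fin K → ℝ) {p : ℝ → ℝ}
    (hp : Measurable p) {η : ℝ} (hr : ∀ k, ∀ x ∈ market K k, |r k - p x| ≤ η) :
    IntegrableOn (fun x => |piecewisePrice q x - p x|) (Icc 0 1) ∧
    ∫ x in Icc (0 : ℝ) 1, |piecewisePrice q x - p x| ≤ (∑ k, |q k - r k|) * (1 / K) + η := by
  have hpt : ∀ᵐ x ∂((volume : Measure ℝ).restrict (Icc 0 1)), |piecewisePrice q x - p x|
      ≤ ∑ k, (market K k).indicator (fun _ => |q k - r k|) x + η := by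
    have hne : ∀ᵐ x : ℝ, x ≠ 1 := by simp [ae_iff]
    filter_upwards [ae_restrict_mem measurableSet_Icc, ae_restrict_of_ae hne] with x hx hx1
    obtain ⟨k, hk⟩ := exists_mem_market hK ⟨hx.1, lt_of_le_of_ne hx.2 hx1⟩
    have h1 : (market K k).indicator (fun _ => |q k - r k|) x
        ≤ ∑ k, (market K k).indicator (fun _ => |q k - r k|) x :=
      Finset.single_le_sum (f := fun k => (market K k).indicator (fun _ => |q k - r k|) x)
        (fun k _ => indicator_nonneg (fun _ _ => abs_nonneg _) _) (Finset.mem_univ k)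
    rw [indicator_of_mem hk] at h1
    rw [piecewisePrice_eq q hk]
    have := abs_sub_le (q k) (r k) (p x)
    linarith [hr k x hk]
  have hind : ∀ k : Fin K, Integrable ((market K k).indicator fun _ => |q k - r k|)
      ((volume : Measure ℝ).restrict (Icc 0 1)) := fun k =>
    (integrable_const _).indicator (measurableSet_market k)
  have hsum : Integrable (fun x => ∑ k, (market K k).indicator (fun _ => |q k - r k|) x)
      ((volume : Measure ℝ).restrict (Icc 0 1)) := integrable_finsetSum _ fun k _ => hind k
  have hbd : Integrable (fun x => ∑ k, (market K k).indicator (fun _ => |q k - r k|) x + η)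
      ((volume : Measure ℝ).restrict (Icc 0 1)) := hsum.add (integrable_const η)
  have hint : IntegrableOn (fun x => |piecewisePrice q x - p x|) (Icc 0 1) := by
    refine hbd.mono' (((measurable_piecewisePrice q).sub hp).abs).aestronglyMeasurable ?_
    filter_upwards [hpt] with x hx
    rwa [Real.norm_eq_abs, abs_abs]
  refine ⟨hint, (integral_mono_ae hint hbd hpt).trans (le_of_eq ?_)⟩
  rw [integral_add hsum (integrable_const η), integral_finsetSum _ fun k _ => hind k,
    Finset.sum_mul]
  congr 1
  · refine Finset.sum_congr rfl fun k _ => ?_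
    rw [integral_indicator_const _ (measurableSet_market k), measureReal_restrict_apply
      (measurableSet_market k), inter_eq_left.mpr (market_subset k), volume_real_market, smul_eq_mul,
      mul_comm]
  · simp

/-! ### The best single price in a market -/

namespace JointDist

variable {J : JointDist} {C₀ Cs Cb U L : ℝ}

theorem InClass.le_law_real_market (h : J.InClass C₀ Cs Cb U L) (hC₀ : 0 ≤ C₀)
    {K : ℕ} (k : Fin K) : L / K ≤ J.law.real {z | z.2 ∈ market K k} := by
  have h1 := h.law_real_eq hC₀ MeasurableSet.univ (measurableSet_market k)
  simp only [mem_univ, and_true, univ_inter] at h1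
  rw [h1, inter_eq_left.mpr (market_subset k)]
  have hm := setIntegral_mono_on (μ := volume) (s := market K k) (f := fun _ => L)
    (g := fun x => J.fX x * ∫ y in Icc (0 : ℝ) 1, J.f y x) (integrableOn_const (by simp [market]))
    (((J.integrable_fX).mono_set (market_subset k)).congr (by
      filter_upwards [ae_restrict_mem (measurableSet_market k)] with x hx
      rw [J.integral_f x (market_subset k hx), mul_one])) (measurableSet_market k)
    (fun x hx => by
      rw [J.integral_f x (market_subset k hx), mul_one]
      exact (h.marginal x (market_subset k hx)).1)
  rw [setIntegral_const, volume_real_market, smul_eq_mul] at hm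
  calc L / K = 1 / K * L := by ring
    _ ≤ _ := hm

/-- The bound scales with the mass of the market, which keeps the constant M = 1 + C₀ in
`integral_abs_erm_sub_le` free of K. -/
theorem InClass.law_real_market_strip_le (h : J.InClass C₀ Cs Cb U L) (hC₀ : 0 ≤ C₀)
    {K : ℕ} (k : Fin K) {a b : ℝ} (hab : a ≤ b) :
    J.law.real ({z | z.2 ∈ market K k} ∩ {z | a ≤ z.1 ∧ z.1 < b})
      ≤ (1 + C₀) * J.law.real {z | z.2 ∈ market K k} * (b - a) := by
  have h1 := h.law_real_eq hC₀ MeasurableSet.univ (measurableSet_market k)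
  have h2 := h.law_real_eq hC₀ (measurableSet_Ico (a := a) (b := b)) (measurableSet_market k)
  simp only [mem_univ, and_true, univ_inter] at h1
  have hset : {z : ℝ × ℝ | z.2 ∈ market K k} ∩ {z | a ≤ z.1 ∧ z.1 < b}
      = {z | z.2 ∈ market K k ∧ z.1 ∈ Ico a b} := rfl
  have hS := inter_eq_left.mpr (market_subset k)
  rw [hS] at h1 h2
  have hfX := (J.integrable_fX).mono_set (market_subset k)
  have h1' : J.law.real {z | z.2 ∈ market K k} = ∫ x in market K k, J.fX x := by
    rw [h1]
    refine integral_congr_ae ?_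
    filter_upwards [ae_restrict_mem (measurableSet_market k)] with x hx
    rw [J.integral_f x (market_subset k hx), mul_one]
  rw [hset, h2, h1', mul_comm (1 + C₀), mul_assoc, ← integral_mul_const]
  refine integral_mono_of_nonneg ?_ (hfX.mul_const _) ?_
  · filter_upwards [ae_restrict_mem (measurableSet_market k)] with x hx
    exact mul_nonneg (J.fX_nonneg x (market_subset k hx))
      (setIntegral_nonneg (measurableSet_Ico.inter measurableSet_Icc)
        fun y hy => J.f_nonneg y hy.2 x (market_subset k hx))
  · filter_upwards [ae_restrict_mem (measurableSet_market k)] with x hx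
    refine mul_le_mul_of_nonneg_left ?_ (J.fX_nonneg x (market_subset k hx))
    calc ∫ y in Ico a b ∩ Icc 0 1, J.f y x ≤ ∫ _ in Ico a b ∩ Icc 0 1, (1 + C₀) := by
          refine setIntegral_mono_on ((J.integrable_f x (market_subset k hx)).mono_set
            inter_subset_right) (integrableOn_const ?_) (measurableSet_Ico.inter measurableSet_Icc)
            fun y hy => h.f_le hC₀ hy.2 (market_subset k hx)
          exact ((measure_mono inter_subset_left).trans_lt measure_Ico_lt_top).ne
      _ = (volume : Measure ℝ).real (Ico a b ∩ Icc 0 1) * (1 + C₀) := by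
          rw [setIntegral_const, smul_eq_mul]
      _ ≤ (b - a) * (1 + C₀) := by
          refine mul_le_mul_of_nonneg_right ?_ (by linarith)
          rw [← Real.volume_real_Ico_of_le hab]
          exact measureReal_mono inter_subset_left measure_Ico_lt_top.ne
      _ = _ := mul_comm _ _

theorem InClass.mul_law_real_market (h : J.InClass C₀ Cs Cb U L) (hC₀ : 0 ≤ C₀)
    {K : ℕ} (k : Fin K) {p : ℝ} (hp : p ∈ Icc (0 : ℝ) 1) :
    p * J.law.real ({z | z.2 ∈ market K k} ∩ {z | p ≤ z.1})
      = ∫ x in market K k, J.rev p x * J.fX x := by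
  have h2 := h.law_real_eq hC₀ (measurableSet_Ici (a := p)) (measurableSet_market k)
  have hset : {z : ℝ × ℝ | z.2 ∈ market K k} ∩ {z | p ≤ z.1}
      = {z | z.2 ∈ market K k ∧ z.1 ∈ Ici p} := rfl
  have hpI : Ici p ∩ Icc 0 1 = Icc p 1 := by
    ext y; simp only [mem_inter_iff, mem_Ici, mem_Icc]
    constructor
    · rintro ⟨h1, _, h3⟩; exact ⟨h1, h3⟩
    · rintro ⟨h1, h3⟩; exact ⟨h1, hp.1.trans h1, h3⟩
  rw [hset, h2, inter_eq_left.mpr (market_subset k), hpI, ← integral_const_mul]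
  refine integral_congr_ae ?_
  filter_upwards [ae_restrict_mem (measurableSet_market k)] with x hx
  rw [setIntegral_f_eq hp (market_subset k hx), rev]
  ring

/-- The optimal uniform price within a market: it has quadratic growth, and it is close to the
pointwise optimal prices in that market. -/
theorem InClass.exists_marketPrice (h : J.InClass C₀ Cs Cb U L) (hC₀ : 0 ≤ C₀) (hCs : 0 < Cs)
    (hL : 0 < L) {p : ℝ → ℝ} (hp : ∀ x ∈ Icc (0 : ℝ) 1,
      p x ∈ Ioo (0 : ℝ) 1 ∧ IsMaxOn (fun y => J.rev y x) (Icc 0 1) (p x)) {l : ℝ} (hl : 0 ≤ l)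
    (hlip : ∀ x ∈ Icc (0 : ℝ) 1, ∀ x' ∈ Icc (0 : ℝ) 1, |p x' - p x| ≤ l * |x' - x|)
    {K : ℕ} (k : Fin K) :
    ∃ r ∈ Icc (0 : ℝ) 1, (∀ x ∈ market K k, |r - p x| ≤ 2 * l / K) ∧
      ∀ q ∈ Icc (0 : ℝ) 1, Cs / 4 * J.law.real {z | z.2 ∈ market K k} * (q - r) ^ 2
        ≤ r * J.law.real ({z | z.2 ∈ market K k} ∩ {z | r ≤ z.1})
          - q * J.law.real ({z | z.2 ∈ market K k} ∩ {z | q ≤ z.1}) := by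
  have := h.isProbabilityMeasure_law hC₀
  have hK : (0 : ℝ) < K := by exact_mod_cast k.pos
  set B : Set (ℝ × ℝ) := {z | z.2 ∈ market K k} with hB
  set m := J.law.real B with hm
  have hm0 : 0 < m := (by positivity : 0 < L / K).trans_le (h.le_law_real_market hC₀ k)
  set R : ℝ → ℝ := fun q => q * J.law.real (B ∩ {z | q ≤ z.1}) with hR
  have hH : Continuous fun q : ℝ => J.law.real (B ∩ {z | q ≤ z.1}) := by
    refine (LipschitzWith.of_dist_le_mul (K := ((1 + C₀) * m).toNNReal) fun s t => ?_).continuous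
    rw [Real.dist_eq, Real.dist_eq, Real.coe_toNNReal _ (by positivity)]
    wlog hst : s ≤ t generalizing s t
    · rw [abs_sub_comm, abs_sub_comm s t]
      exact this t s (le_of_not_ge hst)
    have hsub : B ∩ {z | t ≤ z.1} ⊆ B ∩ {z | s ≤ z.1} :=
      inter_subset_inter_right _ fun z hz => hst.trans hz
    have hmeas : MeasurableSet (B ∩ {z : ℝ × ℝ | t ≤ z.1}) :=
      (measurable_snd (measurableSet_market k)).inter
        (measurableSet_le measurable_const measurable_fst)
    rw [← measureReal_sdiff hsub hmeas, abs_of_nonneg measureReal_nonneg, abs_sub_comm,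
      abs_of_nonneg (sub_nonneg.mpr hst)]
    refine (measureReal_mono ?_).trans (h.law_real_market_strip_le hC₀ k hst)
    rintro z ⟨⟨h1, h2⟩, h3⟩
    refine ⟨h1, h2, ?_⟩
    by_contra hcon
    exact h3 ⟨h1, not_lt.mp hcon⟩
  obtain ⟨r, hr, hrmax⟩ := isCompact_Icc.exists_isMaxOn (nonempty_Icc.mpr zero_le_one)
    ((continuous_id.mul hH).continuousOn (s := Icc (0 : ℝ) 1))
  have hrmax' : IsMaxOn R (Icc 0 1) r := hrmax
  have hint : ∀ q ∈ Icc (0 : ℝ) 1, IntegrableOn (fun x => J.rev q x * J.fX x) (market K k) :=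
    fun q hq => (integrableOn_rev_mul (p := fun _ => q)
      ⟨measurable_const, fun _ _ => hq⟩).mono_set (market_subset k)
  have hReq : ∀ q ∈ Icc (0 : ℝ) 1, R q = ∫ x in market K k, J.rev q x * J.fX x := fun q hq =>
    h.mul_law_real_market hC₀ k hq
  have hmass : m = ∫ x in market K k, J.fX x := by
    have h1 := h.law_real_eq hC₀ MeasurableSet.univ (measurableSet_market k)
    simp only [mem_univ, and_true, univ_inter] at h1
    rw [hm, hB, h1, inter_eq_left.mpr (market_subset k)]
    refine integral_congr_ae ?_
    filter_upwards [ae_restrict_mem (measurableSet_market k)] with x hx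
    rw [J.integral_f x (market_subset k hx), mul_one]
  have hfX := (J.integrable_fX).mono_set (market_subset k)
  have hmid : ∀ a ∈ Icc (0 : ℝ) 1, ∀ b ∈ Icc (0 : ℝ) 1,
      (R a + R b) / 2 + Cs * m / 8 * (b - a) ^ 2 ≤ R ((a + b) / 2) := by
    intro a ha b hb
    have hc : (a + b) / 2 ∈ Icc (0 : ℝ) 1 :=
      ⟨by linarith [ha.1, hb.1], by linarith [ha.2, hb.2]⟩
    rw [hReq a ha, hReq b hb, hReq _ hc]
    have hI := ((hint a ha).add (hint b hb)).div_const 2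
    have hI' : IntegrableOn (fun x => J.fX x * (Cs / 8 * (b - a) ^ 2)) (market K k) :=
      hfX.mul_const _
    have hmono := integral_mono_ae (hI.add hI') (hint _ hc) (by
      have hsc := ae_mono (Measure.restrict_mono (market_subset k) (le_refl (volume : Measure ℝ)))
        h.ae_strongConcave
      filter_upwards [hsc, ae_restrict_mem (measurableSet_market k)] with x hx hxk
      have hx01 := market_subset k hxk
      have hmp := revenue_midpoint (h.lipschitzOnWith_f hx01) hx ha hb
      have := mul_le_mul_of_nonneg_right hmp (J.fX_nonneg x hx01)
      simp only [Pi.add_apply, rev, condCDF]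
      linarith)
    rw [integral_add' hI hI', integral_mul_const, integral_div, integral_add' (hint a ha)
      (hint b hb), ← hmass] at hmono
    linarith
  have hquad : ∀ q ∈ Icc (0 : ℝ) 1, Cs / 4 * m * (q - r) ^ 2 ≤ R r - R q := fun q hq =>
    (le_of_eq (by ring)).trans (quadratic_growth_of_midpoint hmid hr hrmax' hq)
  refine ⟨r, hr, ?_, hquad⟩
  set x₀ : ℝ := (k : ℕ) / K with hx₀
  have hx₀k : x₀ ∈ market K k := left_mem_market k
  have hx₀1 := market_subset k hx₀k
  have hclose : ∀ x ∈ market K k, |p x - p x₀| ≤ l / K := by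
    intro x hx
    refine (hlip x₀ hx₀1 x (market_subset k hx)).trans ?_
    calc l * |x - x₀| ≤ l * (1 / K) :=
          mul_le_mul_of_nonneg_left (abs_sub_le_of_mem_market hx hx₀k) hl
      _ = l / K := by ring
  have hlK : 0 ≤ l / K := by positivity
  -- By quadratic growth, no price other than r can do at least as well as r at every covariate of
  -- the market.
  have hcompare : ∀ q ∈ Icc (0 : ℝ) 1, (∀ x ∈ market K k, J.rev r x ≤ J.rev q x) → r = q := by
    intro q hq hle
    have h1 : R r ≤ R q := by
      rw [hReq r hr, hReq q hq]
      refine setIntegral_mono_on (hint r hr) (hint q hq) (measurableSet_market k) fun x hx => ?_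
      exact mul_le_mul_of_nonneg_right (hle x hx) (J.fX_nonneg x (market_subset k hx))
    have h2 := hquad q hq
    have h3 : (q - r) ^ 2 ≤ 0 := by
      by_contra hcon
      have : 0 < Cs / 4 * m * (q - r) ^ 2 := mul_pos (by positivity) (not_le.mp hcon)
      linarith
    have := pow_eq_zero_iff (n := 2) (by norm_num) |>.mp (le_antisymm h3 (sq_nonneg _))
    linarith
  -- All pointwise optima lie within l/K of p x₀. If r were below that range, raising it to p x₀ -
  -- l/K would, by concavity, lower the revenue at no covariate. The upper bound is symmetric;
  -- comparing p x₀ with p x costs the second l/K.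
  have hlow : p x₀ - l / K ≤ r := by
    by_contra hcon
    push Not at hcon
    have := hcompare (p x₀ - l / K)
      ⟨hr.1.trans hcon.le, by linarith [(hp x₀ hx₀1).1.2]⟩ (fun x hx => by
        have hx1 := market_subset k hx
        refine le_of_concaveOn_of_isMaxOn (h.strictConcave x hx1).concaveOn hr
          (Ioo_subset_Icc_self (hp x hx1).1) ⟨hcon.le, ?_⟩ (hp x hx1).2
        linarith [(abs_le.mp (hclose x hx)).1])
    linarith
  have hhigh : r ≤ p x₀ + l / K := by
    by_contra hcon
    push Not at hcon
    have := hcompare (p x₀ + l / K)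
      ⟨by linarith [(hp x₀ hx₀1).1.1], hcon.le.trans hr.2⟩ (fun x hx => by
        have hx1 := market_subset k hx
        have hmin := (h.strictConcave x hx1).concaveOn.min_le_of_mem_Icc
          (Ioo_subset_Icc_self (hp x hx1).1) hr
          (z := p x₀ + l / K) ⟨by linarith [(abs_le.mp (hclose x hx)).2], hcon.le⟩
        rwa [min_eq_right ((hp x hx1).2 hr)] at hmin)
    linarith
  intro x hx
  have := abs_le.mp (hclose x hx)
  have h2 : 2 * l / K = l / K + l / K := by ring
  rw [h2, abs_le]
  constructor <;> linarith [this.1, this.2]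

end JointDist

/-! ### The rate of the K-markets ERM strategy -/

open Classical in
theorem sum_indicator_eq_card {Ω : Type*} {n : ℕ} (A : Set Ω) (d : Fin n → Ω) :
    ∑ i, A.indicator (fun _ => (1 : ℝ)) (d i) = ((Finset.univ.filter fun i => d i ∈ A).card : ℝ) := by
  simp [indicator, Finset.sum_boole]

namespace JointDist

variable {J : JointDist} {C₀ Cs Cb U L : ℝ}

/-- Clearing the denominator covers empty markets too: both sides are then 0, so the arbitrary price
charged there needs no separate treatment. -/
theorem empMarketRev_le_imp {n : ℕ} (d : Fin n → ℝ × ℝ) (I : Set ℝ) {p q : ℝ}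
    (h : (∃ i, (d i).2 ∈ I) → empMarketRev d I p ≤ empMarketRev d I q) :
    p * ∑ i, ({z : ℝ × ℝ | z.2 ∈ I} ∩ {z | p ≤ z.1}).indicator (fun _ => (1 : ℝ)) (d i)
      ≤ q * ∑ i, ({z : ℝ × ℝ | z.2 ∈ I} ∩ {z | q ≤ z.1}).indicator (fun _ => (1 : ℝ)) (d i) := by
  classical
  by_cases hex : ∃ i, (d i).2 ∈ I
  · have h1 := h hex
    have hpos : (0 : ℝ) < ((Finset.univ.filter fun i => (d i).2 ∈ I).card : ℝ) := by
      obtain ⟨i, hi⟩ := hex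
      exact_mod_cast Finset.card_pos.mpr ⟨i, by simpa using hi⟩
    have h2 := mul_le_mul_of_nonneg_right h1 hpos.le
    have h3 : ∀ p : ℝ, empMarketRev d I p * ((Finset.univ.filter fun i => (d i).2 ∈ I).card : ℝ)
        = p * ∑ i, ({z : ℝ × ℝ | z.2 ∈ I} ∩ {z | p ≤ z.1}).indicator (fun _ => (1 : ℝ)) (d i) := by
      intro p
      rw [empMarketRev, mul_assoc, sum_indicator_eq_card]
      congr 1
      refine (div_mul_cancel₀ _ hpos.ne').trans ?_
      congr!
    rwa [h3, h3] at h2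
  · push Not at hex
    have : ∀ r : ℝ, ∑ i, ({z : ℝ × ℝ | z.2 ∈ I} ∩ {z | r ≤ z.1}).indicator (fun _ => (1 : ℝ)) (d i)
        = 0 := fun r => Finset.sum_eq_zero fun i _ => indicator_of_notMem (fun hi => hex i hi.1) _
    rw [this, this, mul_zero, mul_zero]

theorem InClass.integral_abs_marketPrice_sub_le (h : J.InClass C₀ Cs Cb U L) (hC₀ : 0 ≤ C₀)
    (hCs : 0 < Cs) (hL : 0 < L) {n K : ℕ} (hn : 1 ≤ n) {π : (Fin n → ℝ × ℝ) → Fin K → ℝ}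
    (hπ : IsKMarketsERM n K π) (k : Fin K) {r : ℝ} (hr : r ∈ Icc (0 : ℝ) 1)
    (hquad : ∀ q ∈ Icc (0 : ℝ) 1, Cs / 4 * J.law.real {z | z.2 ∈ market K k} * (q - r) ^ 2
        ≤ r * J.law.real ({z | z.2 ∈ market K k} ∩ {z | r ≤ z.1})
          - q * J.law.real ({z | z.2 ∈ market K k} ∩ {z | q ≤ z.1})) :
    ∫ d, |π d k - r| ∂(Measure.pi fun _ : Fin n => J.law)
      ≤ (1 + 3 * ((512 * (1 + C₀) + 16) / (Cs / 4) ^ 2)) * (n * (L / K)) ^ (-(1 / 3) : ℝ) := by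
  have := h.isProbabilityMeasure_law hC₀
  have hK : (0 : ℝ) < K := by exact_mod_cast k.pos
  have hn0 : (0 : ℝ) < n := by exact_mod_cast hn
  have hqL := h.le_law_real_market hC₀ k
  have hLK : 0 < L / K := by positivity
  refine (integral_abs_erm_sub_le hn J.law (B := {z | z.2 ∈ market K k}) (Y := Prod.fst)
    (M := 1 + C₀) (q := J.law.real {z | z.2 ∈ market K k}) (c := Cs / 4)
    (measurable_snd (measurableSet_market k)) measurable_fst (by linarith) (hLK.trans_le hqL)
    (by positivity) le_rfl (fun a b hab => h.law_real_market_strip_le hC₀ k hab) hr hquad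
    ((measurable_pi_apply k).comp hπ.measurable) (fun d => hπ.mem d k)
    (fun d => empMarketRev_le_imp d _ fun hex => hπ.isMax d k hex hr)).trans ?_
  refine mul_le_mul_of_nonneg_left ?_ (by positivity)
  exact Real.rpow_le_rpow_of_nonpos (by positivity) (mul_le_mul_of_nonneg_left hqL hn0.le)
    (by norm_num)

/-- Serves to make welfare at the ERM prices measurable in the sample. -/
theorem InClass.continuous_welfare_piecewisePrice (h : J.InClass C₀ Cs Cb U L) (hC₀ : 0 ≤ C₀)
    (hU : 0 ≤ U) {K : ℕ} (hK : 0 < K) :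
    Continuous fun q : Fin K → ℝ => welfare J.law (piecewisePrice q) := by
  refine (LipschitzWith.of_dist_le_mul (K := ((1 + C₀) * U).toNNReal) fun q q' => ?_).continuous
  have hK0 : (0 : ℝ) < K := by exact_mod_cast hK
  rw [Real.dist_eq, Real.coe_toNNReal _ (by positivity)]
  have hb := integral_abs_piecewisePrice_sub_le hK q q' (measurable_piecewisePrice q') (η := 0)
    (fun k x hx => by rw [piecewisePrice_eq q' hx]; simp)
  refine (h.abs_welfare_sub_le hC₀ hU (measurable_piecewisePrice q) (measurable_piecewisePrice q')
    hb.1).trans (mul_le_mul_of_nonneg_left (hb.2.trans ?_) (by positivity))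
  have hs : ∑ k, |q k - q' k| ≤ ∑ _k : Fin K, dist q q' :=
    Finset.sum_le_sum fun k _ => dist_le_pi_dist q q' k
  simp only [Finset.sum_const, Finset.card_univ, Fintype.card_fin, nsmul_eq_mul] at hs
  calc (∑ k, |q k - q' k|) * (1 / K) + 0 ≤ (K * dist q q') * (1 / K) + 0 := by gcongr
    _ = dist q q' := by field_simp; ring

theorem InClass.integral_abs_welfare_sub_le (h : J.InClass C₀ Cs Cb U L) (hC₀ : 0 < C₀)
    (hCs : 0 < Cs) (hCb : 0 < Cb) (hU : 0 < U) (hL : 0 < L) {n K : ℕ} (hn : 1 ≤ n) (hK : 0 < K)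
    {π : (Fin n → ℝ × ℝ) → Fin K → ℝ} (hπ : IsKMarketsERM n K π) {pD : ℝ → ℝ}
    (hpD : J.IsOptimal pD) :
    Integrable (fun d => |welfare J.law (piecewisePrice (π d)) - welfare J.law pD|)
      (Measure.pi fun _ : Fin n => J.law) ∧
    ∫ d, |welfare J.law (piecewisePrice (π d)) - welfare J.law pD|
        ∂(Measure.pi fun _ : Fin n => J.law)
      ≤ (1 + C₀) * U * ((1 + 3 * ((512 * (1 + C₀) + 16) / (Cs / 4) ^ 2))
        * (n * (L / K)) ^ (-(1 / 3) : ℝ) + 2 * (Cb / Cs) / K) := by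
  have hprob := h.isProbabilityMeasure_law hC₀.le
  have hK0 : (0 : ℝ) < K := by exact_mod_cast hK
  obtain ⟨p, hp, hplip⟩ := h.exists_optimalPrice hCs hCb
  choose r hr hrp hrquad using fun k : Fin K =>
    h.exists_marketPrice hC₀.le hCs hL hp (by positivity : 0 ≤ Cb / Cs) hplip k
  -- Off [0,1] the curve p is arbitrary; the constant extension is continuous, hence a measurable
  -- pricing function.
  set p' : ℝ → ℝ := IccExtend zero_le_one (fun x : Icc (0 : ℝ) 1 => p x) with hp'
  have hp'eq : ∀ x ∈ Icc (0 : ℝ) 1, p' x = p x := fun x hx => by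
    rw [hp', IccExtend_of_mem _ _ hx]
  have hp'meas : Measurable p' := by
    refine Continuous.measurable (Continuous.Icc_extend' ?_)
    refine (LipschitzWith.of_dist_le_mul (K := (Cb / Cs).toNNReal) fun s t => ?_).continuous
    rw [Real.coe_toNNReal _ (by positivity), Subtype.dist_eq, Real.dist_eq, Real.dist_eq]
    exact hplip t t.2 s s.2
  have hp'pr : IsPricing p' :=
    ⟨hp'meas, fun x hx => by rw [hp'eq x hx]; exact Ioo_subset_Icc_self (hp x hx).1⟩
  have hae := h.isOptimal_ae_eq hL hp'pr (fun x hx => by rw [hp'eq x hx]; exact (hp x hx).2) hpD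
  have hpt : ∀ d, |welfare J.law (piecewisePrice (π d)) - welfare J.law pD|
      ≤ (1 + C₀) * U * ((∑ k, |π d k - r k|) * (1 / K) + 2 * (Cb / Cs) / K) := by
    intro d
    have hb := integral_abs_piecewisePrice_sub_le hK (π d) r hp'meas (η := 2 * (Cb / Cs) / K)
      (fun k x hx => by rw [hp'eq x (market_subset k hx)]; exact hrp k x hx)
    have heq : (fun x => |piecewisePrice (π d) x - p' x|)
        =ᵐ[volume.restrict (Icc (0 : ℝ) 1)] fun x => |piecewisePrice (π d) x - pD x| := by
      filter_upwards [hae] with x hx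
      rw [hx]
    have hw := h.abs_welfare_sub_le hC₀.le hU.le (measurable_piecewisePrice (π d)) hpD.1.1
      (hb.1.congr heq)
    rw [← integral_congr_ae heq] at hw
    exact hw.trans (mul_le_mul_of_nonneg_left hb.2 (by positivity))
  have hmk : ∀ k, Measurable fun d => |π d k - r k| := fun k =>
    (((measurable_pi_apply k).comp hπ.measurable).sub measurable_const).abs
  have hik : ∀ k, Integrable (fun d => |π d k - r k|) (Measure.pi fun _ : Fin n => J.law) := by
    intro k
    refine Integrable.of_bound (hmk k).aestronglyMeasurable 1 (ae_of_all _ fun d => ?_)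
    rw [Real.norm_eq_abs, abs_abs, abs_le]
    have h1 := hπ.mem d k
    have h2 := hr k
    constructor <;> linarith [h1.1, h1.2, h2.1, h2.2]
  have hsum : Integrable (fun d => ∑ k, |π d k - r k|) (Measure.pi fun _ : Fin n => J.law) :=
    integrable_finsetSum _ fun k _ => hik k
  have hbd : Integrable (fun d => (1 + C₀) * U * ((∑ k, |π d k - r k|) * (1 / K)
      + 2 * (Cb / Cs) / K)) (Measure.pi fun _ : Fin n => J.law) :=
    ((hsum.mul_const _).add (integrable_const _)).const_mul _
  have hmeas : Measurable fun d => |welfare J.law (piecewisePrice (π d)) - welfare J.law pD| :=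
    (((h.continuous_welfare_piecewisePrice hC₀.le hU.le hK).measurable.comp hπ.measurable).sub
      measurable_const).abs
  have hint : Integrable (fun d => |welfare J.law (piecewisePrice (π d)) - welfare J.law pD|)
      (Measure.pi fun _ : Fin n => J.law) := by
    refine hbd.mono' hmeas.aestronglyMeasurable (ae_of_all _ fun d => ?_)
    rw [Real.norm_eq_abs, abs_abs]
    exact hpt d
  refine ⟨hint, (integral_mono hint hbd hpt).trans ?_⟩
  rw [integral_const_mul, integral_add (hsum.mul_const _) (integrable_const _),
    integral_mul_const, integral_finsetSum _ fun k _ => hik k]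
  refine mul_le_mul_of_nonneg_left ?_ (by positivity)
  -- The K markets obey the same bound and each has length 1/K, so the factors of K cancel.
  have hs := Finset.sum_le_sum fun k (_ : k ∈ Finset.univ) =>
    h.integral_abs_marketPrice_sub_le hC₀.le hCs hL hn hπ k (hr k) (hrquad k)
  simp only [Finset.sum_const, Finset.card_univ, Fintype.card_fin, nsmul_eq_mul] at hs
  have := mul_le_mul_of_nonneg_right hs (by positivity : (0 : ℝ) ≤ 1 / K)
  rw [mul_comm (K : ℝ), mul_assoc, mul_one_div_cancel hK0.ne', mul_one] at this
  simp only [integral_const, probReal_univ, one_smul]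
  linarith

end JointDist

/-! ### The uniform ERM strategy -/

namespace MargDist

variable {G : MargDist} {C₀ Cs Cb : ℝ}

theorem law_real_eq {A : Set ℝ} (hA : MeasurableSet A) :
    G.law.real A = ∫ y in A ∩ Icc 0 1, G.g y := by
  have hint := G.integrable_g.mono_set (inter_subset_right : A ∩ Icc (0 : ℝ) 1 ⊆ Icc 0 1)
  rw [Measure.real, law, withDensity_apply _ hA, Measure.restrict_restrict hA,
    ← ofReal_integral_eq_lintegral_ofReal hint, ENNReal.toReal_ofReal]
  · exact setIntegral_nonneg (hA.inter measurableSet_Icc) fun y hy => G.g_nonneg y hy.2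
  · filter_upwards [ae_restrict_mem (hA.inter measurableSet_Icc)] with y hy
      using G.g_nonneg y hy.2

theorem isProbabilityMeasure_law : IsProbabilityMeasure G.law := by
  have h1 := G.law_real_eq MeasurableSet.univ
  rw [univ_inter, G.integral_g, Measure.real, ENNReal.toReal_eq_one_iff] at h1
  exact ⟨h1⟩

theorem ae_law_mem_Icc : ∀ᵐ y ∂G.law, y ∈ Icc (0 : ℝ) 1 := by
  rw [law]
  exact (withDensity_absolutelyContinuous _ _).ae_le (ae_restrict_mem measurableSet_Icc)

theorem InClass.law_real_Icc_le (h : G.InClass C₀ Cs Cb) (hC₀ : 0 ≤ C₀) {a b : ℝ} (hab : a ≤ b) :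
    G.law.real (Icc a b) ≤ (1 + C₀) * (b - a) := by
  rw [law_real_eq measurableSet_Icc]
  calc ∫ y in Icc a b ∩ Icc 0 1, G.g y ≤ ∫ _ in Icc a b ∩ Icc 0 1, (1 + C₀) := by
        refine setIntegral_mono_on (G.integrable_g.mono_set inter_subset_right)
          (integrableOn_const ?_) (measurableSet_Icc.inter measurableSet_Icc)
          fun y hy => le_of_integral_eq_one hC₀ h.lipschitz G.integrable_g G.integral_g hy.2
        exact ((measure_mono inter_subset_left).trans_lt measure_Icc_lt_top).ne
    _ = (volume : Measure ℝ).real (Icc a b ∩ Icc 0 1) * (1 + C₀) := by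
        rw [setIntegral_const, smul_eq_mul]
    _ ≤ (b - a) * (1 + C₀) := by
        refine mul_le_mul_of_nonneg_right ?_ (by linarith)
        rw [← Real.volume_real_Icc_of_le hab]
        exact measureReal_mono inter_subset_left measure_Icc_lt_top.ne
    _ = _ := mul_comm _ _

theorem InClass.abs_welfareU_sub_le (h : G.InClass C₀ Cs Cb) (hC₀ : 0 ≤ C₀) (p p' : ℝ) :
    |welfareU G.law p - welfareU G.law p'| ≤ (1 + C₀) * |p - p'| := by
  have := G.isProbabilityMeasure_law
  refine (abs_welfare_sub_le G.law (Y := fun y => y) (s := fun _ => p) (t := fun _ => p')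
    measurable_id measurable_const measurable_const ae_law_mem_Icc).trans ?_
  refine (h.law_real_Icc_le hC₀ min_le_max).trans (le_of_eq ?_)
  rw [max_sub_min_eq_abs, abs_sub_comm]

theorem mul_law_real {p : ℝ} (hp : p ∈ Icc (0 : ℝ) 1) :
    p * G.law.real (univ ∩ {y | p ≤ y}) = G.rev p := by
  have hpI : Ici p ∩ Icc 0 1 = Icc p 1 := by
    ext y; simp only [mem_inter_iff, mem_Ici, mem_Icc]
    constructor
    · rintro ⟨h1, _, h3⟩; exact ⟨h1, h3⟩
    · rintro ⟨h1, h3⟩; exact ⟨h1, hp.1.trans h1, h3⟩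
  have hint : ∀ a ∈ Icc (0 : ℝ) 1, ∀ b ∈ Icc (0 : ℝ) 1,
      IntervalIntegrable G.g volume a b := fun a ha b hb =>
    (G.integrable_g.mono_set (uIcc_subset_Icc ha hb)).intervalIntegrable
  have h01 : ∫ t in (0 : ℝ)..1, G.g t = 1 := by
    rw [intervalIntegral.integral_of_le zero_le_one, ← integral_Icc_eq_integral_Ioc, G.integral_g]
  have h2 := intervalIntegral.integral_add_adjacent_intervals (hint 0 (by simp) p hp)
    (hint p hp 1 (by simp))
  have h3 := G.law_real_eq (measurableSet_Ici (a := p))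
  rw [hpI, integral_Icc_eq_integral_Ioc, ← intervalIntegral.integral_of_le hp.2] at h3
  have hset : univ ∩ {y : ℝ | p ≤ y} = Ici p := univ_inter _
  rw [hset, h3, rev]
  congr 1
  linarith

theorem empRev_le_imp {n : ℕ} (hn : 1 ≤ n) (d : Fin n → ℝ) {p q : ℝ}
    (h : empRev d p ≤ empRev d q) :
    p * ∑ i, (univ ∩ {y : ℝ | p ≤ y}).indicator (fun _ => (1 : ℝ)) (d i)
      ≤ q * ∑ i, (univ ∩ {y : ℝ | q ≤ y}).indicator (fun _ => (1 : ℝ)) (d i) := by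
  classical
  have hpos : (0 : ℝ) < n := by exact_mod_cast hn
  rw [univ_inter, univ_inter, sum_indicator_eq_card, sum_indicator_eq_card]
  have h2 := mul_le_mul_of_nonneg_right h hpos.le
  have h3 : ∀ p : ℝ, empRev d p * (n : ℝ)
      = p * ((Finset.univ.filter fun i => d i ∈ {y : ℝ | p ≤ y}).card : ℝ) := by
    intro p
    rw [empRev, mul_assoc]
    congr 1
    exact (div_mul_cancel₀ _ hpos.ne').trans rfl
  rw [h3, h3] at h2
  exact h2

/-- The case of a single market B = `univ` with q = 1: the target is the optimal price itself, so
there is no bias term. -/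
theorem InClass.integral_abs_welfareU_sub_le (h : G.InClass C₀ Cs Cb) (hC₀ : 0 < C₀)
    (hCs : 0 < Cs) {n : ℕ} (hn : 1 ≤ n) {π : (Fin n → ℝ) → ℝ} (hπ : IsUniformERM n π) {pU : ℝ}
    (hpU : G.IsOptimal pU) :
    Integrable (fun d => |welfareU G.law (π d) - welfareU G.law pU|)
      (Measure.pi fun _ : Fin n => G.law) ∧
    ∫ d, |welfareU G.law (π d) - welfareU G.law pU| ∂(Measure.pi fun _ : Fin n => G.law)
      ≤ (1 + C₀) * (1 + 3 * ((512 * (1 + C₀) + 16) / (Cs / 4) ^ 2))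
        * (n : ℝ) ^ (-(1 / 3) : ℝ) := by
  have hprob := G.isProbabilityMeasure_law
  have hglip := lipschitzOnWith_of_abs_sub_le h.lipschitz
  have hquad : ∀ p ∈ Icc (0 : ℝ) 1, Cs / 4 * 1 * (p - pU) ^ 2
      ≤ pU * G.law.real (univ ∩ {y | pU ≤ y}) - p * G.law.real (univ ∩ {y | p ≤ y}) := by
    intro p hp
    rw [mul_law_real hpU.1, mul_law_real hp, mul_one]
    exact quadratic_growth_of_midpoint
      (fun a ha b hb => revenue_midpoint hglip h.strongConcave ha hb) hpU.1 hpU.2 hp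
  have herm := integral_abs_erm_sub_le hn G.law (B := univ) (Y := fun y => y) (M := 1 + C₀)
    (q := 1) (c := Cs / 4) MeasurableSet.univ measurable_id (by linarith) one_pos (by positivity)
    measureReal_le_one
    (fun a b hab => by
      rw [mul_one]
      exact (measureReal_mono (s₂ := Icc a b) fun y hy => ⟨hy.2.1, hy.2.2.le⟩).trans
        (h.law_real_Icc_le hC₀.le hab))
    hpU.1 hquad hπ.measurable hπ.mem (fun d => empRev_le_imp hn d (hπ.isMax d hpU.1))
  rw [mul_one] at herm
  have hcont : Continuous fun p => welfareU G.law p := by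
    refine (LipschitzWith.of_dist_le_mul (K := (1 + C₀).toNNReal) fun p q => ?_).continuous
    rw [Real.dist_eq, Real.dist_eq, Real.coe_toNNReal _ (by positivity)]
    exact h.abs_welfareU_sub_le hC₀.le p q
  have hbd : Integrable (fun d => (1 + C₀) * |π d - pU|) (Measure.pi fun _ : Fin n => G.law) := by
    have hm : Measurable fun d => |π d - pU| := (hπ.measurable.sub measurable_const).abs
    refine Integrable.const_mul (Integrable.of_bound hm.aestronglyMeasurable 1
      (ae_of_all _ fun d => ?_)) _
    rw [Real.norm_eq_abs, abs_abs, abs_le]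
    have h1 := hπ.mem d
    have h2 := hpU.1
    constructor <;> linarith [h1.1, h1.2, h2.1, h2.2]
  have hint : Integrable (fun d => |welfareU G.law (π d) - welfareU G.law pU|)
      (Measure.pi fun _ : Fin n => G.law) := by
    refine hbd.mono' (((hcont.measurable.comp hπ.measurable).sub
      measurable_const).abs).aestronglyMeasurable (ae_of_all _ fun d => ?_)
    rw [Real.norm_eq_abs, abs_abs]
    exact h.abs_welfareU_sub_le hC₀.le _ _
  refine ⟨hint, (integral_mono hint hbd fun d => h.abs_welfareU_sub_le hC₀.le _ _).trans ?_⟩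
  rw [integral_const_mul, mul_assoc]
  exact mul_le_mul_of_nonneg_left herm (by linarith)

end MargDist

/-- The rate obtained when the number of markets is of order `n ^ (1 / 4)`. -/
theorem rpow_market_rate_le {L c₁ c₂ : ℝ} (hL : 0 < L) (hc₁ : 0 < c₁) (hc₂ : 0 < c₂) {n K : ℕ}
    (hn : 1 ≤ n) (h₁ : c₁ * (n : ℝ) ^ (1 / 4 : ℝ) ≤ K) (h₂ : (K : ℝ) ≤ c₂ * (n : ℝ) ^ (1 / 4 : ℝ)) :
    0 < K ∧ (n * (L / K)) ^ (-(1 / 3) : ℝ) ≤ (L / c₂) ^ (-(1 / 3) : ℝ) * (n : ℝ) ^ (-(1 / 4) : ℝ) ∧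
      1 / (K : ℝ) ≤ 1 / c₁ * (n : ℝ) ^ (-(1 / 4) : ℝ) := by
  have hn0 : (0 : ℝ) < n := by exact_mod_cast hn
  have hx : 0 < (n : ℝ) ^ (1 / 4 : ℝ) := Real.rpow_pos_of_pos hn0 _
  have hK : (0 : ℝ) < K := (by positivity : 0 < c₁ * (n : ℝ) ^ (1 / 4 : ℝ)).trans_le h₁
  refine ⟨by exact_mod_cast hK, ?_, ?_⟩
  · have h34 : (n : ℝ) = (n : ℝ) ^ (3 / 4 : ℝ) * (n : ℝ) ^ (1 / 4 : ℝ) := by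
      rw [← Real.rpow_add hn0]; norm_num
    -- The expected number of observations per market is at least of order n^(3/4), and its power
    -- -1/3 is n^(-1/4).
    have hle : L / c₂ * (n : ℝ) ^ (3 / 4 : ℝ) ≤ n * (L / K) := by
      rw [← mul_div_assoc, le_div_iff₀ hK]
      calc L / c₂ * (n : ℝ) ^ (3 / 4 : ℝ) * K
          ≤ L / c₂ * (n : ℝ) ^ (3 / 4 : ℝ) * (c₂ * (n : ℝ) ^ (1 / 4 : ℝ)) := by gcongr
        _ = ((n : ℝ) ^ (3 / 4 : ℝ) * (n : ℝ) ^ (1 / 4 : ℝ)) * L := by field_simp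
        _ = n * L := by rw [← h34]
    refine (Real.rpow_le_rpow_of_nonpos (by positivity) hle (by norm_num)).trans (le_of_eq ?_)
    rw [Real.mul_rpow (by positivity) (by positivity), ← Real.rpow_mul hn0.le]
    norm_num
  · rw [Real.rpow_neg hn0.le, ← one_div, one_div_mul_one_div]
    exact one_div_le_one_div_of_le (by positivity) h₁

end Pricing

/-- Integrability accompanies each bound because the Bochner integral of a non-integrable function
is 0, which would make the bound say nothing. -/
theorem theorem6 :
    -- (i) the K-markets ERM strategy
    (∀ C₀ Cs Cb U L : ℝ, 0 < C₀ → 0 < Cs → 0 < Cb → 0 < U → 0 < L →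
      ∀ c₁ c₂ : ℝ, 0 < c₁ → 0 < c₂ →
      ∃ C : ℝ, 0 < C ∧ ∀ n K : ℕ, 1 ≤ n →
        c₁ * (n : ℝ) ^ (1 / 4 : ℝ) ≤ (K : ℝ) → (K : ℝ) ≤ c₂ * (n : ℝ) ^ (1 / 4 : ℝ) →
        ∀ π : (Fin n → ℝ × ℝ) → Fin K → ℝ, Pricing.IsKMarketsERM n K π →
        ∀ J : Pricing.JointDist, J.InClass C₀ Cs Cb U L →
        ∀ pD : ℝ → ℝ, J.IsOptimal pD →
          MeasureTheory.Integrable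
            (fun d => |Pricing.welfare J.law (Pricing.piecewisePrice (π d))
              - Pricing.welfare J.law pD|)
            (MeasureTheory.Measure.pi fun _ : Fin n => J.law) ∧
          ∫ d, |Pricing.welfare J.law (Pricing.piecewisePrice (π d))
              - Pricing.welfare J.law pD| ∂(MeasureTheory.Measure.pi fun _ : Fin n => J.law)
            ≤ C * (n : ℝ) ^ (-(1 / 4) : ℝ)) ∧
    -- (ii) the uniform ERM strategy
    (∀ C₀ Cs Cb : ℝ, 0 < C₀ → 0 < Cs → 0 < Cb →
      ∃ C : ℝ, 0 < C ∧ ∀ n : ℕ, 1 ≤ n →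
        ∀ π : (Fin n → ℝ) → ℝ, Pricing.IsUniformERM n π →
        ∀ G : Pricing.MargDist, G.InClass C₀ Cs Cb →
        ∀ pU : ℝ, G.IsOptimal pU →
          MeasureTheory.Integrable
            (fun d => |Pricing.welfareU G.law (π d) - Pricing.welfareU G.law pU|)
            (MeasureTheory.Measure.pi fun _ : Fin n => G.law) ∧
          ∫ d, |Pricing.welfareU G.law (π d) - Pricing.welfareU G.law pU|
              ∂(MeasureTheory.Measure.pi fun _ : Fin n => G.law)
            ≤ C * (n : ℝ) ^ (-(1 / 3) : ℝ)) := by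
  constructor
  · intro C₀ Cs Cb U L hC₀ hCs hCb hU hL c₁ c₂ hc₁ hc₂
    have hA : 0 < (L / c₂) ^ (-(1 / 3) : ℝ) := Real.rpow_pos_of_pos (by positivity) _
    refine ⟨(1 + C₀) * U * ((1 + 3 * ((512 * (1 + C₀) + 16) / (Cs / 4) ^ 2))
      * (L / c₂) ^ (-(1 / 3) : ℝ) + 2 * (Cb / Cs) * (1 / c₁)), by positivity, ?_⟩
    intro n K hn h₁ h₂ π hπ J hJ pD hpD
    obtain ⟨hK, hr1, hr2⟩ := Pricing.rpow_market_rate_le hL hc₁ hc₂ hn h₁ h₂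
    obtain ⟨hint, hle⟩ := hJ.integral_abs_welfare_sub_le hC₀ hCs hCb hU hL hn hK hπ hpD
    refine ⟨hint, hle.trans ?_⟩
    rw [mul_assoc ((1 + C₀) * U), add_mul (_ * _) (2 * (Cb / Cs) * (1 / c₁))]
    refine mul_le_mul_of_nonneg_left (add_le_add ?_ ?_) (by positivity)
    · rw [mul_assoc]
      exact mul_le_mul_of_nonneg_left hr1 (by positivity)
    · rw [mul_assoc, div_eq_mul_one_div]
      exact mul_le_mul_of_nonneg_left hr2 (by positivity)
  · intro C₀ Cs Cb hC₀ hCs hCb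
    refine ⟨(1 + C₀) * (1 + 3 * ((512 * (1 + C₀) + 16) / (Cs / 4) ^ 2)), by positivity, ?_⟩
    intro n hn π hπ G hG pU hpU
    exact hG.integral_abs_welfareU_sub_le hC₀ hCs hn hπ hpU
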